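/- **Setting.** Let $H=\sum_{j=1}^r\theta_jP_j$ be an $n$-qubit Hamiltonian, where $P_1,\dots,P_r\in\{I,\sigma_x,\sigma_y,\sigma_z\}^{\otimes n}\setminus\{I^{\otimes n}\}$ are known, distinct Pauli strings and $\Theta=(\theta_1,\dots,\theta_r)\in\mathbb R^r$, $\Theta\neq0$, is unknown; write $\|\Theta\|_\infty=\max_j|\theta_j|$. The interaction graph $\mathcal G$ has the terms as vertices, distinct terms being adjacent if their supports intersect; $\mathscr D$ is its maximum degree, and we assume $\mathscr D\ge1$. The squared graph $\mathcal G^2$ joins distinct terms $P_i,P_k$ whenever some term $P_j$ has a support meeting both $\operatorname{supp}P_i$ and $\operatorname{supp}P_k$. Put $\tau=1/(2\mathscr D\|\Theta\|_\infty)$. One query consists of preparing a state $\rho_0$, evolving it to $\rho(t)=e^{-iHt}\rho_0e^{iHt}$ for a time $t\ge0$, and measuring a set of single-qubit Paulis on distinct qubits; different queries are independent. **Algorithm** (PartitionInferCoefficients, with parameters $N,L,K\in\mathbb N$ and $A>0$). Color $\mathcal G^2$ greedily with $\mathscr D^2+1$ colors. For each term choose (in any way) a single-qubit Pauli $P_j'$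 with $[P_j',P_j]\ne0$. For each color class $\mathbf V$ let $\rho_0$ be the state that equals $2^{-|\operatorname{supp}P_j|}\bigl(I+\tfrac i2[P_j,P_j']\bigr)$ on $\operatorname{supp}P_j$ for every $P_j\in\mathbf V$ and is maximally mixed on all other qubits. For each color class, each $k=1,\dots,K$ and each $\ell=1,\dots,L$, let $z_\ell=-\cos\bigl(\tfrac{2\ell-1}{2L}\pi\bigr)$ and $t_\ell=\tfrac A2(1+z_\ell)$, make $N$ queries with initial state $\rho_0$ and time $t_\ell$ that measure all $P_j'$, $P_j\in\mathbf V$, simultaneously, and for each $P_j\in\mathbf V$ let $y_\ell$ be the mean of the $N$ outcomes of $P_j'$. With $\tilde b_m=\frac2L\sum_{\ell=1}^Ly_\ell T_m(z_\ell)$, where $T_m$ is the $m$-th Chebyshev polynomial, put $$\tilde\theta_j^{(k)}=\tfrac12\Bigl(-\tfrac2A\sum_{m=1}^{L-1}(-1)^m\,\tilde b_m\,m^2\Bigr),$$ and output $\tilde\theta_j=\operatorname{median}_{k}\tilde\theta^{(k)}_j$ for every $j$. **Theorem (Hamiltonian learning with unitary dynamics).** There are absolute constants $C>0$ and $p\in\mathbb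 N$ such that for all $r$, all $\mathscr D\ge1$, all $0<\varepsilon\le1$ and all $0<\delta<1$ there are $N,L,K\in\mathbb N$ and $a>0$, depending on $r,\mathscr D,\varepsilon,\delta$ only, such that for every Hamiltonian as above with $r$ terms, interaction degree $\mathscr D$ and any number of qubits, and for every admissible choice of the $P_j'$, the algorithm run with $N,L,K$ and $A=a\tau$ has the following properties. 1. The greedy coloring is a proper coloring of $\mathcal G^2$, and every initial state $\rho_0$ is a convex mixture of product states $\bigotimes_q\rho_q$ with each $\rho_q$ either $I/2$ or an eigenstate $(I\pm\sigma_a)/2$ of a Pauli matrix; so product-state preparations, forward time evolution and single-qubit Pauli measurements are enough. 2. With probability at least $1-\delta$, $|\tilde\theta_j-\theta_j|\le\varepsilon\|\Theta\|_\infty$ for all $j=1,\dots,r$. 3. The number of queries is at most $C\,\mathscr D^4\log(r/\delta)\,\bigl(1+\log(\mathscr D/\varepsilon)\bigr)^p/\varepsilon^2$. 4. For every outcome of the measurements, the classical processing (coloring $\mathcal G^2$, given the adjacency lists of $\mathcal G$, and computing all $\tilde\theta_j$ from the outcomes) takes at most $C\,\mathscr D^2\,r\log(r/\delta)\,\bigl(1+\log(\mathscr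 D/\varepsilon)\bigr)^p/\varepsilon^2$ elementary steps of a unit-cost real random access machine (real arithmetic, cosine, comparisons, memory accesses), the medians being found by a linear-time selection algorithm. -/

import Mathlib

noncomputable section

namespace HamLearn

/-! ## Qubits, Pauli strings, Hamiltonians -/

/-- The three nontrivial single-qubit Pauli axes. -/
inductive Axis : Type
  | x
  | y
  | z
  deriving DecidableEq

/-- The Pauli matrices `σ_x, σ_y, σ_z`. -/
def Axis.mat : Axis → Matrix (Fin 2) (Fin 2) ℂ
  | .x => !![0, 1; 1, 0]
  | .y => !![0, -Complex.I; Complex.I, 0]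
  | .z => !![1, 0; 0, -1]

/-- Operators on `n` qubits, as matrices in the computational basis `Fin n → Fin 2`. -/
abbrev Operator (n : ℕ) : Type := Matrix (Fin n → Fin 2) (Fin n → Fin 2) ℂ

/-- The tensor product over the `n` sites of the single-qubit operators `M q`. -/
def siteTensor {n : ℕ} (M : Fin n → Matrix (Fin 2) (Fin 2) ℂ) : Operator n :=
  fun a b => ∏ q, M q (a q) (b q)

/-- An element of `{I, σ_x, σ_y, σ_z}^{⊗ n}`; at each site, `none` stands for `I`. -/
abbrev PauliString (n : ℕ) : Type := Fin n → Option Axis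

/-- The `2^n × 2^n` matrix of a Pauli string. -/
def pauliOp {n : ℕ} (P : PauliString n) : Operator n :=
  siteTensor fun q => match P q with
    | none => 1
    | some a => a.mat

/-- The Pauli string acting as `σ_a` on site `q` and trivially elsewhere. -/
def singlePauli {n : ℕ} (q : Fin n) (a : Axis) : PauliString n :=
  fun q' => if q' = q then some a else none

/-- The set of sites on which a Pauli string acts nontrivially. -/
def supp {n : ℕ} (P : PauliString n) : Finset (Fin n) :=
  Finset.univ.filter fun q => P q ≠ none

/-- `H = ∑ j, θ_j P_j`. -/
def hamiltonian {n r : ℕ} (P : Fin r → PauliString n) (θ : Fin r → ℝ) : Operator n :=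
  ∑ j, ((θ j : ℝ) : ℂ) • pauliOp (P j)

/-- The interaction graph: terms are adjacent when they are distinct and their supports meet. -/
def interactionGraph {n r : ℕ} (P : Fin r → PauliString n) : SimpleGraph (Fin r) where
  Adj i j := i ≠ j ∧ (supp (P i) ∩ supp (P j)).Nonempty
  symm := ⟨fun i j h => ⟨h.1.symm, by rw [Finset.inter_comm]; exact h.2⟩⟩
  loopless := ⟨fun _ h => h.1 rfl⟩

instance {n r : ℕ} (P : Fin r → PauliString n) : DecidableRel (interactionGraph P).Adj :=
  fun i j => inferInstanceAs (Decidable (i ≠ j ∧ (supp (P i) ∩ supp (P j)).Nonempty))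

/-- The squared interaction graph: distinct terms are adjacent when some term of the Hamiltonian
has a support that meets both of their supports. -/
def squaredGraph {n r : ℕ} (P : Fin r → PauliString n) : SimpleGraph (Fin r) where
  Adj i k := i ≠ k ∧ ∃ j, (supp (P i) ∩ supp (P j)).Nonempty ∧ (supp (P j) ∩ supp (P k)).Nonempty
  symm := ⟨fun i k h => by
    obtain ⟨hne, j, h1, h2⟩ := h
    exact ⟨hne.symm, j, by rwa [Finset.inter_comm], by rwa [Finset.inter_comm]⟩⟩
  loopless := ⟨fun _ h => h.1 rfl⟩

/-! ## Access to the black box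

A query prepares a state, lets it evolve under the unknown Hamiltonian for some time, and measures
single-qubit Paulis. -/

/-- The value `+1` or `-1` of a binary measurement outcome. -/
def sgn (b : Bool) : ℝ := if b then 1 else -1

/-- A single-qubit state: `none` is the maximally mixed state `I / 2`, and `some (a, b)` is the
eigenstate `(I ± σ_a) / 2`. -/
def siteState : Option (Axis × Bool) → Matrix (Fin 2) (Fin 2) ℂ
  | none => (1 / 2 : ℂ) • 1
  | some (a, b) => (1 / 2 : ℂ) • (1 + ((sgn b : ℝ) : ℂ) • a.mat)

/-- The `n`-qubit product states that can be prepared. -/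
def productState {n : ℕ} (s : Fin n → Option (Axis × Bool)) : Operator n :=
  siteTensor fun q => siteState (s q)

/-- One query: an initial density matrix, an evolution time, and for every qubit either the axis
of the Pauli that is measured on it or `none` when it is not measured. -/
structure Query (n : ℕ) where
  init : Operator n
  time : ℝ
  setting : Fin n → Option Axis

/-- `e^{-iHt} ρ e^{iHt}`. -/
def evolve {n : ℕ} (H : Operator n) (t : ℝ) (ρ : Operator n) : Operator n :=
  NormedSpace.exp ((-(Complex.I * (t : ℂ))) • H) * ρ * NormedSpace.exp ((Complex.I * (t : ℂ)) • H)

/-- The projector for outcome `s` of a product Pauli measurement. The outcome recorded for a qubit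
that is not measured is always `true`. -/
def effect {n : ℕ} (setting : Fin n → Option Axis) (s : Fin n → Bool) : Operator n :=
  siteTensor fun q => match setting q with
    | none => if s q then 1 else 0
    | some a => (1 / 2 : ℂ) • (1 + ((sgn (s q) : ℝ) : ℂ) • a.mat)

/-- The law of the outcome of a query, by the Born rule. -/
def Query.law {n : ℕ} (H : Operator n) (Q : Query n) : MeasureTheory.Measure (Fin n → Bool) :=
  ∑ s : Fin n → Bool,
    ENNReal.ofReal (Matrix.trace (effect Q.setting s * evolve H Q.time Q.init)).re •
      MeasureTheory.Measure.dirac s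

/-! ## Step-counted classical computation

Unit-cost real random access machine: an arithmetic operation, an evaluation of the cosine, a
comparison, a memory access, and a list-cell operation cost one step each. -/

/-- A value together with the number of elementary steps spent on computing it. -/
structure Timed (α : Type) where
  val : α
  steps : ℕ

namespace Timed

instance : Monad Timed where
  pure a := ⟨a, 0⟩
  bind x f := ⟨(f x.val).val, x.steps + (f x.val).steps⟩

/-- One elementary operation, with result `a`. -/
def op {α : Type} (a : α) : Timed α := ⟨a, 1⟩

/-- Fill an array of length `m`; each entry costs its own computation and one write. -/
def tabulate {α : Type} {m : ℕ} (f : Fin m → Timed α) : Timed (Fin m → α) :=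
  ⟨fun i => (f i).val, ∑ i, ((f i).steps + 1)⟩

/-- Accumulate a sum; each summand costs its own computation, one addition and one increment of
the loop counter. -/
def sum {ι : Type} (s : Finset ι) (f : ι → Timed ℝ) : Timed ℝ :=
  ⟨∑ i ∈ s, (f i).val, ∑ i ∈ s, ((f i).steps + 2)⟩

/-- Copy an array of length `m` into a list. -/
def toList {α : Type} {m : ℕ} (f : Fin m → α) : Timed (List α) := ⟨List.ofFn f, m + 1⟩

/-- The length of a list, by traversal. -/
def length {α : Type} (l : List α) : Timed ℕ := ⟨l.length, l.length + 1⟩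

end Timed

open Timed

/-! ### Median in linear time (median of medians) -/

section Select

variable {α : Type} [LinearOrder α]

/-- Insert an element into a sorted list. -/
def insertT (a : α) : List α → Timed (List α)
  | [] => op [a]
  | b :: l => do
    let c ← op (decide (a ≤ b))
    if c then op (a :: b :: l)
    else do
      let t ← insertT a l
      op (b :: t)

/-- Insertion sort. -/
def insertionSortT : List α → Timed (List α)
  | [] => op []
  | a :: l => do
    let t ← insertionSortT l
    insertT a t

/-- The medians of the consecutive full groups of five elements. -/
def groupMedians : List α → Timed (List α)
  | a :: b :: c :: d :: e :: l => do
    let s ← insertionSortT [a, b, c, d, e]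
    let t ← groupMedians l
    op (s.getD 2 a :: t)
  | _ => op []

/-- Three-way partition of a list into the elements below, equal to and above the pivot. -/
def split3 (p : α) : List α → Timed (List α × List α × List α)
  | [] => op ([], [], [])
  | a :: l => do
    let t ← split3 p l
    let c ← op (decide (a < p))
    let d ← op (decide (p < a))
    if c then op (a :: t.1, t.2.1, t.2.2)
    else if d then op (t.1, t.2.1, a :: t.2.2)
    else op (t.1, a :: t.2.1, t.2.2)

/-- The element at position `i` (counted from zero) of the sorted version of `l`. The first
argument bounds the depth of the recursion; any bound larger than the length of `l` is enough. -/
def select (dflt : α) : ℕ → List α → ℕ → Timed α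
  | 0, _, _ => op dflt
  | fuel + 1, l, i => do
    let len ← Timed.length l
    let small ← op (decide (len < 25))
    if small then do
      let s ← insertionSortT l
      let _ ← Timed.length s
      op (s.getD i dflt)
    else do
      let ms ← groupMedians l
      let m ← Timed.length ms
      let h ← op (m / 2)
      let p ← select dflt fuel ms h
      let t ← split3 p l
      let nlt ← Timed.length t.1
      let neq ← Timed.length t.2.1
      let nle ← op (nlt + neq)
      let inLower ← op (decide (i < nlt))
      let inMiddle ← op (decide (i < nle))
      if inLower then select dflt fuel t.1 i
      else if inMiddle then op p
      else do
        let i' ← op (i - nle)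
        select dflt fuel t.2.2 i'

end Select

/-- The median of a list of reals (the mean of the two middle elements when the length is
even). -/
def medianT (l : List ℝ) : Timed ℝ := do
  let len ← Timed.length l
  let i ← op (len - 1)
  let i ← op (i / 2)
  let j ← op (len / 2)
  let fuel ← op (len + 1)
  let a ← select 0 fuel l i
  let b ← select 0 fuel l j
  let c ← op (a + b)
  op (c / 2)

/-! ### Greedy coloring of the squared interaction graph -/

/-- The adjacency list of a term in the interaction graph. -/
def adjList {n r : ℕ} (P : Fin r → PauliString n) (i : Fin r) : List (Fin r) :=
  (List.finRange r).filter fun j => (interactionGraph P).Adj i j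

/-- Mark the colors that are already assigned to the listed vertices. -/
def markList {r m : ℕ} (col : Fin r → Option (Fin (m + 1))) :
    List (Fin r) → (Fin (m + 1) → Bool) → Timed (Fin (m + 1) → Bool)
  | [], mark => op mark
  | u :: l, mark => do
    let c ← op (col u)
    let mark' ← op (match c with
      | none => mark
      | some c => Function.update mark c true)
    markList col l mark'

/-- Mark the colors assigned to the listed vertices and to their neighbors. -/
def markBalls {r m : ℕ} (adj : Fin r → List (Fin r)) (col : Fin r → Option (Fin (m + 1))) :
    List (Fin r) → (Fin (m + 1) → Bool) → Timed (Fin (m + 1) → Bool)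
  | [], mark => op mark
  | u :: l, mark => do
    let nbrs ← op (u :: adj u)
    let mark' ← markList col nbrs mark
    markBalls adj col l mark'

/-- The smallest color that is not marked (the last color if all are marked). -/
def firstFree : (m : ℕ) → (Fin (m + 1) → Bool) → Timed (Fin (m + 1))
  | 0, _ => op 0
  | m + 1, mark => do
    let used ← op (mark 0)
    if used then do
      let c ← firstFree m fun i => mark i.succ
      op c.succ
    else op 0

/-- Color the listed vertices greedily, one after the other, with `m + 1` colors. -/
def greedyLoop {r : ℕ} (m : ℕ) (adj : Fin r → List (Fin r)) :
    List (Fin r) → (Fin r → Option (Fin (m + 1))) → Timed (Fin r → Option (Fin (m + 1)))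
  | [], col => op col
  | v :: l, col => do
    let blank ← tabulate fun _ : Fin (m + 1) => op false
    let mark ← markBalls adj col (adj v) blank
    let c ← firstFree m mark
    let col' ← op (Function.update col v (some c))
    greedyLoop m adj l col'

/-- Greedy coloring with `m + 1` colors of the square of a graph given by adjacency lists. -/
def graphColor {r : ℕ} (m : ℕ) (adj : Fin r → List (Fin r)) : Timed (Fin r → Fin (m + 1)) := do
  let col ← greedyLoop m adj (List.finRange r) fun _ => none
  tabulate fun v => op ((col v).getD 0)

/-! ### Chebyshev regression -/

/-- The roots `z_ℓ = -cos ((2ℓ - 1) π / (2L))` of the `L`-th Chebyshev polynomial; the index here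
starts at zero. -/
def chebNode (L : ℕ) (l : Fin L) : ℝ :=
  -Real.cos ((2 * (l : ℝ) + 1) / (2 * (L : ℝ)) * Real.pi)

/-- Step-counted evaluation of `chebNode`. -/
def chebNodeT (L : ℕ) (l : Fin L) : Timed ℝ := do
  let a ← op (2 * (l : ℝ))
  let a ← op (a + 1)
  let b ← op (2 * (L : ℝ))
  let a ← op (a / b)
  let a ← op (a * Real.pi)
  let a ← op (Real.cos a)
  op (-a)

/-- `(T_m(z), T_{m+1}(z))` by the three-term recurrence. -/
def chebPairT (z : ℝ) : ℕ → Timed (ℝ × ℝ)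
  | 0 => op (1, z)
  | m + 1 => do
    let p ← chebPairT z m
    let a ← op (2 * z)
    let a ← op (a * p.2)
    let a ← op (a - p.1)
    op (p.2, a)

/-- The estimate `b_m = (2/L) ∑ ℓ, y_ℓ T_m(z_ℓ)` of the `m`-th Chebyshev coefficient. -/
def chebCoeffT {L : ℕ} (y : Fin L → ℝ) (m : ℕ) : Timed ℝ := do
  let s ← Timed.sum Finset.univ fun l => do
    let z ← chebNodeT L l
    let p ← chebPairT z m
    op (y l * p.1)
  let a ← op (2 / (L : ℝ))
  op (a * s)

/-- The estimate `-(2/A) ∑_{m=1}^{L-1} (-1)^m b_m m^2` of the derivative at time zero. -/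
def derivativeT (A : ℝ) {L : ℕ} (y : Fin L → ℝ) : Timed ℝ := do
  let s ← Timed.sum (Finset.Icc 1 (L - 1)) fun m => do
    let b ← chebCoeffT y m
    let e ← op (if Even m then (1 : ℝ) else -1)
    let q ← op ((m : ℝ) * (m : ℝ))
    let b ← op (b * q)
    op (e * b)
  let a ← op (2 / A)
  let a ← op (a * s)
  op (-a)

/-! ## The learning algorithm -/

/-- Labels of the queries: color, repetition `k`, Chebyshev node `ℓ`, and shot. -/
abbrev Run (m N L K : ℕ) : Type := Fin (m + 1) × Fin K × Fin L × Fin N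

/-- The measured outcomes of all queries. -/
abbrev Record (n m N L K : ℕ) : Type := Run m N L K → Fin n → Bool

/-- The terms of color `c`. -/
def colorClass {r m : ℕ} (col : Fin r → Fin (m + 1)) (c : Fin (m + 1)) : List (Fin r) :=
  (List.finRange r).filter fun j => col j = c

/-- The initial state for color `c`: the state `(I + i [P_j, P_j'] / 2) / 2^{|supp P_j|}` on the
support of each term `P_j` of color `c`, and the maximally mixed state on all other qubits. Here
`P_j'` is the single-qubit Pauli at the site and axis `probe j`. -/
def initialState {n r m : ℕ} (P : Fin r → PauliString n) (probe : Fin r → Fin n × Axis)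
    (col : Fin r → Fin (m + 1)) (c : Fin (m + 1)) : Operator n :=
  ((2 : ℂ) ^ n)⁻¹ • ((colorClass col c).map fun j =>
    (1 : Operator n) + (Complex.I / 2) •
      (pauliOp (P j) * pauliOp (singlePauli (probe j).1 (probe j).2) -
        pauliOp (singlePauli (probe j).1 (probe j).2) * pauliOp (P j))).prod

/-- Measure `P_j'` for all terms `P_j` of color `c` simultaneously. -/
def probeSetting {n r m : ℕ} (probe : Fin r → Fin n × Axis) (col : Fin r → Fin (m + 1))
    (c : Fin (m + 1)) : Fin n → Option Axis :=
  fun q => ((colorClass col c).find? fun j => (probe j).1 = q).map fun j => (probe j).2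

/-- The queries that the algorithm makes; those of repetition `k` and node `ℓ` evolve for the time
`t_ℓ = (A/2) (1 + z_ℓ)`. -/
def queries {n r m : ℕ} (P : Fin r → PauliString n) (probe : Fin r → Fin n × Axis)
    (col : Fin r → Fin (m + 1)) (N L K : ℕ) (A : ℝ) (w : Run m N L K) : Query n where
  init := initialState P probe col w.1
  time := A / 2 * (1 + chebNode L w.2.2.1)
  setting := probeSetting probe col w.1

/-- The joint law of all outcomes: the queries are independent. -/
def recordLaw {n r m : ℕ} (P : Fin r → PauliString n) (θ : Fin r → ℝ)
    (probe : Fin r → Fin n × Axis) (col : Fin r → Fin (m + 1)) (N L K : ℕ) (A : ℝ) :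
    MeasureTheory.Measure (Record n m N L K) :=
  MeasureTheory.Measure.pi fun w => (queries P probe col N L K A w).law (hamiltonian P θ)

/-- The processing of the measured data: for every term, the median over the `K` repetitions of
half the Chebyshev estimate of the derivative at time zero of the expectation of `P_j'`. (That
derivative is `Tr (i [H, P_j'] ρ₀) = 2 θ_j`.) -/
def processData {n r m N L K : ℕ} (probe : Fin r → Fin n × Axis) (A : ℝ)
    (col : Fin r → Fin (m + 1)) (data : Record n m N L K) : Timed (Fin r → ℝ) :=
  tabulate fun j => do
    let c ← op (col j)
    let est ← tabulate fun k : Fin K => do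
      let y ← tabulate fun l : Fin L => do
        let s ← Timed.sum Finset.univ fun i : Fin N => do
          let b ← op (data (c, k, l, i) (probe j).1)
          op (sgn b)
        op (s / (N : ℝ))
      let d ← derivativeT A y
      op (d / 2)
    let l ← Timed.toList est
    medianT l

/-- The complete classical computation: color the squared interaction graph, then process the
data. -/
def classicalPart {n r : ℕ} (m : ℕ) {N L K : ℕ} (P : Fin r → PauliString n)
    (probe : Fin r → Fin n × Axis) (A : ℝ) (data : Record n m N L K) : Timed (Fin r → ℝ) := do
  let col ← graphColor m (adjList P)
  processData probe A col data

end HamLearn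

end

/-!
The algorithm reads `2 θ_j` off the derivative at time zero of `f_j(t) = Tr (P_j' ρ(t))`.

*What the derivative is.* `f_j'(0) = Tr (i [H, P_j'] ρ₀)`, and only terms `P_k` anticommuting with
`P_j'` enter. Two terms of one color are not adjacent in the squared interaction graph, so their
supports are disjoint, and a term meeting `P_j` meets no other term of that color. Hence `ρ₀` is
`2⁻ⁿ ∏ (1 ± Q_i)` for Pauli strings `Q_i` with disjoint supports, `± Q_j` being
`i [P_j, P_j'] / 2`. The term `P_j` contributes `2 θ_j`, because `ρ₀` is stabilized by `± Q_j`.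
For `k ≠ j` some Pauli string anticommutes with the product of `P_k` and `P_j'` but commutes
with every `Q_i`, so this contribution vanishes
(`trace_strMul_initialState_eq_zero`, `trace_heisenberg_probe`).
Diagonalizing all `Q_i` site by site also shows that `ρ₀` is a mixture of product states
(`stabilizerOp_mem_convexHull`).

*Why short times are enough.* The `k`-th derivative of `f_j` is the expectation of a `k`-fold
nested commutator with `H`. Each commutator enlarges the region occupied by an operator by the
support of one term, and a region made of `m` supports meets at most `m (D + 1)` terms. Therefore
the derivative is at most `k! (2 (D + 1) ‖θ‖) ^ k` (`norm_trace_heisenberg_pow_le`), and on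
`[0, A]` the function is its Taylor polynomial up to an error that decays geometrically in the
degree (`norm_expectation_sub_taylor_le`).

*Why the regression works.* By discrete orthogonality of the Chebyshev polynomials, the estimator
is exact on polynomials of degree less than `L` (`sum_chebWeight_mul_eval`), and its weights are
polynomially bounded in `L`. So its bias is exponentially small in `L` (`bias_le`), while its
variance is of order `L ^ 5 / (A ^ 2 N)`. Chebyshev's inequality bounds the failure probability of
one repetition by `1 / 64`; the repetitions are independent, so the median fails with probability
at most `4 ^ (-K)` (`measure_median_far_le`), and a union bound over the terms finishes the
argument with `L ~ log (D / ε)`, `N ~ L ^ 5 D ^ 2 / ε ^ 2` and `K ~ log (r / δ)`.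

*Classical cost.* A vertex of the squared graph has at most `D ^ 2` neighbors, so the greedy
coloring never runs out of colors (`graphColor_proper`); selection by the median of medians is
linear (`select_spec`); and with the above parameters reading the outcomes dominates everything
else (`classicalPart_steps`).
-/

namespace HamLearn

/-! ### Values and step counts of timed computations -/

namespace Timed

@[simp] lemma val_bind {α β : Type} (x : Timed α) (f : α → Timed β) :
    (x >>= f).val = (f x.val).val := rfl

@[simp] lemma steps_bind {α β : Type} (x : Timed α) (f : α → Timed β) :
    (x >>= f).steps = x.steps + (f x.val).steps := rfl

@[simp] lemma val_op {α : Type} (a : α) : (op a).val = a := rfl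

@[simp] lemma steps_op {α : Type} (a : α) : (op a).steps = 1 := rfl

@[simp] lemma val_length {α : Type} (l : List α) : (Timed.length l).val = l.length := rfl

@[simp] lemma steps_length {α : Type} (l : List α) : (Timed.length l).steps = l.length + 1 := rfl

@[simp] lemma val_sum {ι : Type} (s : Finset ι) (f : ι → Timed ℝ) :
    (Timed.sum s f).val = ∑ i ∈ s, (f i).val := rfl

lemma steps_tabulate_le {α : Type} {m c : ℕ} (f : Fin m → Timed α) (h : ∀ i, (f i).steps ≤ c) :
    (tabulate f).steps ≤ m * (c + 1) := by
  have : ∑ i : Fin m, ((f i).steps + 1) ≤ ∑ _i : Fin m, (c + 1) :=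
    Finset.sum_le_sum fun i _ => Nat.add_le_add_right (h i) 1
  simpa [tabulate] using this

lemma steps_sum_le {ι : Type} {c : ℕ} (s : Finset ι) (f : ι → Timed ℝ)
    (h : ∀ i ∈ s, (f i).steps ≤ c) : (Timed.sum s f).steps ≤ s.card * (c + 2) := by
  have : ∑ i ∈ s, ((f i).steps + 2) ≤ ∑ _i ∈ s, (c + 2) :=
    Finset.sum_le_sum fun i hi => Nat.add_le_add_right (h i hi) 2
  simpa [Timed.sum] using this

end Timed

open Timed

/-! ### Selection of order statistics -/

section Select

variable {α : Type} [LinearOrder α]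

lemma insertT_val (a : α) (l : List α) : (insertT a l).val = l.orderedInsert (· ≤ ·) a := by
  induction l with
  | nil => rfl
  | cons b l ih =>
    by_cases h : a ≤ b <;> simp [insertT, h, ih]

lemma insertT_steps (a : α) (l : List α) : (insertT a l).steps ≤ 2 * l.length + 2 := by
  induction l with
  | nil => simp [insertT]
  | cons b l ih =>
    by_cases h : a ≤ b <;> simp [insertT, h]
    omega

lemma insertionSortT_val (l : List α) : (insertionSortT l).val = l.insertionSort (· ≤ ·) := by
  induction l with
  | nil => rfl
  | cons b l ih => simp [insertionSortT, insertT_val, ih]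

lemma insertionSortT_steps (l : List α) :
    (insertionSortT l).steps ≤ (2 * l.length + 2) * l.length + 1 := by
  induction l with
  | nil => simp [insertionSortT]
  | cons b l ih =>
    have := insertT_steps b (insertionSortT l).val
    simp only [insertionSortT_val, List.length_insertionSort] at this
    simp only [insertionSortT, steps_bind, insertionSortT_val, List.length_cons]
    nlinarith

/-- `x` occurs in `l`, and in the sorted version of `l` it can be found at position `i`. -/
def IsOrderStat (l : List α) (i : ℕ) (x : α) : Prop :=
  x ∈ l ∧ l.countP (· < x) ≤ i ∧ i < l.countP (· ≤ x)

lemma isOrderStat_sorted {s : List α} (hs : s.Pairwise (· ≤ ·)) {i : ℕ} (hi : i < s.length) :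
    IsOrderStat s i s[i] := by
  refine ⟨List.getElem_mem hi, ?_, ?_⟩
  · obtain ⟨x, hx⟩ : ∃ x, x = s[i] := ⟨_, rfl⟩
    rw [← hx, ← List.take_append_drop i s, List.countP_append, hx]
    have h2 : (s.drop i).countP (· < s[i]) = 0 := by
      rw [List.countP_eq_zero]
      intro a ha
      obtain ⟨k, hk, rfl⟩ := List.mem_iff_getElem.1 ha
      simp only [List.getElem_drop, decide_eq_true_eq, not_lt]
      rcases Nat.eq_zero_or_pos k with rfl | hk0
      · simp
      · exact List.pairwise_iff_getElem.1 hs _ _ _ _ (by omega)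
    rw [h2]
    exact List.countP_le_length.trans (by simp)
  · obtain ⟨x, hx⟩ : ∃ x, x = s[i] := ⟨_, rfl⟩
    rw [← hx, ← List.take_append_drop (i + 1) s, List.countP_append, hx]
    have h1 : (s.take (i + 1)).countP (· ≤ s[i]) = (s.take (i + 1)).length := by
      rw [List.countP_eq_length]
      intro a ha
      obtain ⟨k, hk, rfl⟩ := List.mem_iff_getElem.1 ha
      simp only [List.length_take] at hk
      simp only [List.getElem_take, decide_eq_true_eq]
      rcases Nat.lt_or_ge k i with h | h
      · exact List.pairwise_iff_getElem.1 hs _ _ _ _ h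
      · have : k = i := by omega
        subst this; rfl
    rw [h1, List.length_take]
    omega

lemma IsOrderStat.of_perm {l l' : List α} (h : l.Perm l') {i : ℕ} {x : α}
    (hx : IsOrderStat l i x) : IsOrderStat l' i x :=
  ⟨h.mem_iff.1 hx.1, h.countP_eq _ ▸ hx.2.1, h.countP_eq _ ▸ hx.2.2⟩

lemma isOrderStat_insertionSortT (l : List α) (d : α) {i : ℕ} (hi : i < l.length) :
    IsOrderStat l i ((insertionSortT l).val.getD i d) := by
  rw [insertionSortT_val]
  have hp : (l.insertionSort (· ≤ ·)).Perm l := List.perm_insertionSort _ l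
  have hi' : i < (l.insertionSort (· ≤ ·)).length := by rwa [hp.length_eq]
  rw [List.getD_eq_getElem _ _ hi']
  exact (isOrderStat_sorted (List.pairwise_insertionSort _ l) hi').of_perm hp

lemma split3_val (p : α) (l : List α) :
    (split3 p l).val = (l.filter (· < p), l.filter (· = p), l.filter (p < ·)) := by
  induction l with
  | nil => rfl
  | cons a l ih =>
    rcases lt_trichotomy a p with h | h | h
    · simp [split3, ih, h, h.not_gt, h.ne]
    · simp [split3, ih, h]
    · simp [split3, ih, h, h.not_gt, h.ne']

lemma split3_steps (p : α) (l : List α) : (split3 p l).steps = 3 * l.length + 1 := by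
  induction l with
  | nil => rfl
  | cons a l ih =>
    by_cases h : a < p <;> by_cases h' : p < a <;> simp [split3, ih, h, h'] <;> ring

lemma groupMedians_steps_length (l : List α) :
    (groupMedians l).steps ≤ 13 * l.length + 1 ∧
      (groupMedians l).val.length = l.length / 5 := by
  induction l using groupMedians.induct with
  | case1 a b c d e l ih =>
    have h := insertionSortT_steps [a, b, c, d, e]
    simp only [List.length_cons, List.length_nil] at h
    simp only [groupMedians, steps_bind, steps_op, val_bind, val_op, List.length_cons]
    refine ⟨?_, ?_⟩ <;> omega
  | case2 l h =>
    rcases l with _ | ⟨a, _ | ⟨b, _ | ⟨c, _ | ⟨d, _ | ⟨e, l⟩⟩⟩⟩⟩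
    all_goals first | exact absurd rfl (h _ _ _ _ _ _) | simp [groupMedians]

/-- Each group median that is at most `p` brings along two more elements that are at most `p`, and
likewise from above. -/
lemma groupMedians_count (p : α) (l : List α) :
    3 * (groupMedians l).val.countP (· ≤ p) ≤ l.countP (· ≤ p) ∧
      3 * (groupMedians l).val.countP (p ≤ ·) ≤ l.countP (p ≤ ·) := by
  induction l using groupMedians.induct with
  | case1 a b c d e l ih =>
    have hsp := List.perm_insertionSort (· ≤ ·) [a, b, c, d, e]
    have hso := List.pairwise_insertionSort (· ≤ ·) [a, b, c, d, e]
    have hle := hsp.countP_eq (fun x => decide (x ≤ p))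
    have hge := hsp.countP_eq (fun x => decide (p ≤ x))
    have hsv := insertionSortT_val [a, b, c, d, e]
    have hlen := hsp.length_eq
    generalize List.insertionSort (· ≤ ·) [a, b, c, d, e] = s at *
    have e1 : List.countP (fun x => decide (x ≤ p)) (a :: b :: c :: d :: e :: l) =
        List.countP (fun x => decide (x ≤ p)) s + List.countP (fun x => decide (x ≤ p)) l := by
      rw [hle, ← List.countP_append]; rfl
    have e2 : List.countP (fun x => decide (p ≤ x)) (a :: b :: c :: d :: e :: l) =
        List.countP (fun x => decide (p ≤ x)) s + List.countP (fun x => decide (p ≤ x)) l := by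
      rw [hge, ← List.countP_append]; rfl
    rw [e1, e2]
    simp only [groupMedians, val_bind, val_op, hsv]
    rcases s with _ | ⟨s0, _ | ⟨s1, _ | ⟨s2, _ | ⟨s3, _ | ⟨s4, _ | ⟨s5, s⟩⟩⟩⟩⟩⟩
    all_goals simp only [List.length_cons, List.length_nil] at hlen
    all_goals try omega
    simp only [List.pairwise_cons, List.mem_cons, List.not_mem_nil, or_false, forall_eq_or_imp,
      forall_eq] at hso
    obtain ⟨⟨h01, h02, -, -⟩, ⟨h12, -, -⟩, ⟨h23, h24⟩, -, -⟩ := hso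
    simp only [List.countP_cons, List.countP_nil, List.getD_cons_succ, List.getD_cons_zero,
      decide_eq_true_eq]
    refine ⟨?_, ?_⟩
    · by_cases h2 : s2 ≤ p
      · simp only [h2, h02.trans h2, h12.trans h2, if_true]; omega
      · simp only [h2, if_false]; omega
    · by_cases h2 : p ≤ s2
      · simp only [h2, h2.trans h23, h2.trans h24, if_true]; omega
      · simp only [h2, if_false]; omega
  | case2 l h =>
    rcases l with _ | ⟨a, _ | ⟨b, _ | ⟨c, _ | ⟨d, _ | ⟨e, l⟩⟩⟩⟩⟩
    all_goals first | exact absurd rfl (h _ _ _ _ _ _) | simp [groupMedians]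

lemma countP_lt_add_countP_ge (p : α) (l : List α) :
    l.countP (· < p) + l.countP (p ≤ ·) = l.length := by
  rw [List.length_eq_countP_add_countP (fun x => decide (x < p)) (l := l)]
  simp

lemma countP_le_add_countP_gt (p : α) (l : List α) :
    l.countP (· ≤ p) + l.countP (p < ·) = l.length := by
  rw [List.length_eq_countP_add_countP (fun x => decide (x ≤ p)) (l := l)]
  simp

lemma countP_lt_add_countP_eq (p : α) (l : List α) :
    l.countP (· < p) + l.countP (· = p) = l.countP (· ≤ p) := by
  induction l with
  | nil => rfl
  | cons a l ih =>
    rcases lt_trichotomy a p with h | h | h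
    · simp [h, h.le, h.ne, ← ih]; omega
    · simp [h, ← ih]; omega
    · simp [h.not_gt, h.not_ge, h.ne', ← ih]

lemma countP_filter_of_imp {β : Type*} (l : List β) (f g : β → Bool) (h : ∀ x, g x → f x) :
    (l.filter f).countP g = l.countP g := by
  rw [List.countP_filter]
  refine List.countP_congr fun x _ => ?_
  have := h x
  cases hf : f x <;> cases hg : g x <;> simp_all

lemma countP_eq_add_countP_filter_gt (p : α) (l : List α) (f : α → Bool)
    (hf : ∀ y, y ≤ p → f y) :
    l.countP f = l.countP (· ≤ p) + (l.filter (p < ·)).countP f := by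
  induction l with
  | nil => rfl
  | cons a l ih =>
    rcases le_or_gt a p with h | h
    · rw [List.filter_cons_of_neg (by simpa using h), List.countP_cons_of_pos (hf a h),
        List.countP_cons_of_pos (by simpa using h), ih]
      omega
    · rw [List.filter_cons_of_pos (by simpa using h), List.countP_cons, List.countP_cons,
        List.countP_cons, ih, if_neg (by simpa using h : ¬ decide (a ≤ p) = true)]
      omega

/-- The element found by `select` has the required rank, and the number of steps is linear: the
medians of the groups of five make up a fifth of the list and either side of the pivot at most
about seven tenths, so that the two recursive calls together leave about a tenth of the budget
`2000 * l.length` for the work outside of them. -/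
lemma select_spec (d : α) (fuel : ℕ) (l : List α) (i : ℕ) (hf : l.length < fuel)
    (hi : i < l.length) :
    IsOrderStat l i (select d fuel l i).val ∧
      (select d fuel l i).steps ≤ 2000 * l.length + 10 := by
  induction fuel generalizing l i with
  | zero => omega
  | succ fuel ih =>
    by_cases hsm : l.length < 25
    · have h1 := insertionSortT_steps l
      have h2 : (insertionSortT l).val.length = l.length := by simp [insertionSortT_val]
      refine ⟨?_, ?_⟩
      · have := isOrderStat_insertionSortT l d hi
        simpa [select, hsm] using this
      · simp only [select, steps_bind, val_length, steps_length, val_op, steps_op, hsm,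
          decide_true, if_true, h2]
        have : (2 * l.length + 2) * l.length ≤ 52 * l.length :=
          Nat.mul_le_mul_right _ (by omega)
        omega
    · obtain ⟨hgs, hgl⟩ := groupMedians_steps_length l
      obtain ⟨⟨hp1, hp2, hp3⟩, hps⟩ :=
        ih (groupMedians l).val ((groupMedians l).val.length / 2) (by omega) (by omega)
      set ms := (groupMedians l).val with hms
      set p := (select d fuel ms (ms.length / 2)).val with hp
      -- half of the group medians lie on either side of the pivot, and hence three tenths of `l` do
      obtain ⟨hc1, hc2⟩ := groupMedians_count p l
      rw [← hms] at hc1 hc2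
      have k1 := countP_lt_add_countP_ge p l
      have k2 := countP_le_add_countP_gt p l
      have k3 := countP_lt_add_countP_eq p l
      have k4 := countP_lt_add_countP_ge p ms
      have hs := split3_steps p l
      have fl : (l.filter (· < p)).length = l.countP (· < p) := List.countP_eq_length_filter.symm
      have fe : (l.filter (· = p)).length = l.countP (· = p) := List.countP_eq_length_filter.symm
      have fg : (l.filter (p < ·)).length = l.countP (p < ·) := List.countP_eq_length_filter.symm
      simp only [select, steps_bind, val_bind, val_length, steps_length, val_op, steps_op, hsm,
        decide_false, Bool.false_eq_true, if_false]
      simp only [← hms, ← hp, split3_val, fl, fe, hs]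
      by_cases hlow : i < l.countP (· < p)
      · rw [if_pos (decide_eq_true hlow)]
        obtain ⟨⟨q1, q2, q3⟩, qs⟩ := ih (l.filter (· < p)) i (by omega) (by omega)
        set x := (select d fuel (l.filter (· < p)) i).val
        have hxl := List.mem_filter.1 q1
        have hxp : x < p := by simpa using hxl.2
        refine ⟨⟨hxl.1, ?_, ?_⟩, ?_⟩
        · rwa [countP_filter_of_imp _ _ _ (fun y hy => by
            simp only [decide_eq_true_eq] at hy ⊢; exact hy.trans hxp)] at q2
        · rwa [countP_filter_of_imp _ _ _ (fun y hy => by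
            simp only [decide_eq_true_eq] at hy ⊢; exact hy.trans_lt hxp)] at q3
        · omega
      · rw [if_neg (by simpa using hlow)]
        by_cases hmid : i < l.countP (· < p) + l.countP (· = p)
        · rw [if_pos (decide_eq_true hmid)]
          refine ⟨⟨?_, not_lt.1 hlow, by rw [val_op, ← k3]; exact hmid⟩, ?_⟩
          · have : 0 < l.countP (· = p) := by omega
            obtain ⟨y, hy, hyp⟩ := List.countP_pos_iff.1 this
            simp only [decide_eq_true_eq] at hyp
            exact hyp ▸ hy
          · simp only [steps_op]; omega
        · rw [if_neg (by simpa using hmid)]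
          simp only [steps_bind, val_bind, val_op, steps_op]
          obtain ⟨⟨q1, q2, q3⟩, qs⟩ := ih (l.filter (p < ·))
            (i - (l.countP (· < p) + l.countP (· = p))) (by omega) (by omega)
          set x := (select d fuel (l.filter (p < ·))
            (i - (l.countP (· < p) + l.countP (· = p)))).val
          have hxl := List.mem_filter.1 q1
          have hxp : p < x := by simpa using hxl.2
          refine ⟨⟨hxl.1, ?_, ?_⟩, ?_⟩
          · rw [countP_eq_add_countP_filter_gt p _ _ (fun y hy => by
              simpa using hy.trans_lt hxp)]
            omega
          · rw [countP_eq_add_countP_filter_gt p _ _ (fun y hy => by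
              simpa using hy.trans hxp.le)]
            omega
          · omega

end Select

/-- A median lies in every interval that contains more than half of the elements. -/
lemma medianT_spec (l : List ℝ) (hl : l ≠ []) :
    (medianT l).steps ≤ 4001 * l.length + 30 ∧
      ∀ a b : ℝ, 2 * l.countP (fun x => ¬ (a ≤ x ∧ x ≤ b)) < l.length →
        a ≤ (medianT l).val ∧ (medianT l).val ≤ b := by
  have hpos : 0 < l.length := List.length_pos_iff.2 hl
  obtain ⟨⟨-, u1, u2⟩, us⟩ := select_spec (0 : ℝ) (l.length + 1) l ((l.length - 1) / 2)
    (by omega) (by omega)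
  obtain ⟨⟨-, v1, v2⟩, vs⟩ := select_spec (0 : ℝ) (l.length + 1) l (l.length / 2)
    (by omega) (by omega)
  have key : ∀ (a b x : ℝ) (i : ℕ), (l.length - 1) / 2 ≤ i → i ≤ l.length / 2 →
      l.countP (· < x) ≤ i → i < l.countP (· ≤ x) →
      2 * l.countP (fun x => ¬ (a ≤ x ∧ x ≤ b)) < l.length → a ≤ x ∧ x ≤ b := by
    intro a b x i h1 h2 h3 h4 h5
    constructor
    · by_contra! hx
      have : l.countP (· ≤ x) ≤ l.countP (fun x => ¬ (a ≤ x ∧ x ≤ b)) :=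
        List.countP_mono_left fun y _ hy => by
          simp only [decide_eq_true_eq] at hy ⊢
          exact fun h => absurd h.1 (not_le.2 (hy.trans_lt hx))
      omega
    · by_contra! hx
      have h6 := countP_lt_add_countP_ge x l
      have : l.countP (x ≤ ·) ≤ l.countP (fun x => ¬ (a ≤ x ∧ x ≤ b)) :=
        List.countP_mono_left fun y _ hy => by
          simp only [decide_eq_true_eq] at hy ⊢
          exact fun h => absurd h.2 (not_le.2 (hx.trans_le hy))
      omega
  refine ⟨?_, fun a b hab => ?_⟩
  · simp only [medianT, steps_bind, val_length, steps_length, val_op, steps_op]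
    omega
  · obtain ⟨ha1, ha2⟩ := key a b _ _ le_rfl (by omega) u1 u2 hab
    obtain ⟨hb1, hb2⟩ := key a b _ _ (by omega) le_rfl v1 v2 hab
    simp only [medianT, val_bind, val_length, val_op]
    constructor <;> linarith

/-! ### Greedy coloring of the square of a graph -/

section Coloring

variable {r m : ℕ}

lemma markList_spec (col : Fin r → Option (Fin (m + 1))) (l : List (Fin r))
    (mark : Fin (m + 1) → Bool) :
    (∀ c, (markList col l mark).val c = true ↔ mark c = true ∨ ∃ u ∈ l, col u = some c) ∧
      (markList col l mark).steps ≤ 2 * l.length + 1 := by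
  induction l generalizing mark with
  | nil => simp [markList]
  | cons u l ih =>
    simp only [markList, val_bind, val_op, steps_bind, steps_op, List.length_cons]
    refine ⟨fun c => ?_, ?_⟩
    · rw [(ih _).1]
      cases hu : col u with
      | none => simp [hu]
      | some d =>
        by_cases hcd : c = d
        · simp [hu, hcd]
        · simp [hu, hcd, Ne.symm hcd]
    · refine (Nat.add_le_add_left (Nat.add_le_add_left (ih _).2 1) 1).trans (by omega)

lemma markBalls_spec (adj : Fin r → List (Fin r)) (col : Fin r → Option (Fin (m + 1))) {D : ℕ}
    (hD : ∀ v, (adj v).length ≤ D) (l : List (Fin r)) (mark : Fin (m + 1) → Bool) :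
    (∀ c, (markBalls adj col l mark).val c = true ↔
      mark c = true ∨ ∃ u ∈ l, ∃ w ∈ u :: adj u, col w = some c) ∧
      (markBalls adj col l mark).steps ≤ l.length * (2 * D + 4) + 1 := by
  induction l generalizing mark with
  | nil => simp [markBalls]
  | cons u l ih =>
    simp only [markBalls, val_bind, val_op, steps_bind, steps_op, List.length_cons]
    obtain ⟨h1, h2⟩ := markList_spec col (u :: adj u) mark
    refine ⟨fun c => ?_, ?_⟩
    · rw [(ih _).1, h1]
      simp only [List.mem_cons, exists_eq_or_imp, or_assoc]
    · have := (ih (markList col (u :: adj u) mark).val).2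
      have := hD u
      simp only [List.length_cons] at h2
      nlinarith

lemma firstFree_spec (m : ℕ) (mark : Fin (m + 1) → Bool) :
    ((∃ c, mark c = false) → mark (firstFree m mark).val = false) ∧
      (firstFree m mark).steps ≤ 2 * m + 2 := by
  induction m with
  | zero =>
    refine ⟨fun ⟨c, hc⟩ => ?_, by simp [firstFree]⟩
    have : (firstFree 0 mark).val = c := (Fin.fin_one_eq_zero c).symm
    rw [this, hc]
  | succ m ih =>
    obtain ⟨h1, h2⟩ := ih fun i => mark i.succ
    cases h0 : mark 0 with
    | false => simp [firstFree, h0]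
    | true =>
      simp only [firstFree, val_bind, val_op, steps_bind, steps_op, h0, if_true]
      refine ⟨fun ⟨c, hc⟩ => h1 ?_, by omega⟩
      obtain ⟨c, rfl⟩ := Fin.exists_succ_eq.2 (show c ≠ 0 by rintro rfl; simp_all)
      exact ⟨c, hc⟩

/-- Distinct vertices at distance at most two in the graph given by adjacency lists. -/
def NearAdj (adj : Fin r → List (Fin r)) (v w : Fin r) : Prop :=
  v ≠ w ∧ ∃ u ∈ adj v, w ∈ u :: adj u

lemma NearAdj.symm {adj : Fin r → List (Fin r)} (hs : ∀ v w, w ∈ adj v → v ∈ adj w)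
    {v w : Fin r} (h : NearAdj adj v w) : NearAdj adj w v := by
  obtain ⟨hne, u, hu, hw⟩ := h
  refine ⟨hne.symm, ?_⟩
  rcases List.mem_cons.1 hw with rfl | hw
  · exact ⟨v, hs _ _ hu, List.mem_cons_self⟩
  · exact ⟨u, hs _ _ hw, List.mem_cons_of_mem _ (hs _ _ hu)⟩

/-- While `v` itself is uncolored, each of its at most `D` neighbors `u` blocks at most `D` colors,
because `v` is one of the neighbors of `u`. -/
lemma exists_unblocked {adj : Fin r → List (Fin r)} {D : ℕ}
    (hs : ∀ v w, w ∈ adj v → v ∈ adj w) (hD : ∀ v, (adj v).length ≤ D)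
    (col : Fin r → Option (Fin (D ^ 2 + 1))) (v : Fin r) (hv : col v = none) :
    ∃ c, ¬ ∃ u ∈ adj v, ∃ w ∈ u :: adj u, col w = some c := by
  by_contra! hall
  have hsub : (Finset.univ : Finset (Fin (D ^ 2 + 1))) ⊆
      (adj v).toFinset.biUnion fun u =>
        ((u :: adj u).toFinset.erase v).image fun w => (col w).getD 0 := by
    intro c _
    obtain ⟨u, hu, w, hw, hc⟩ := hall c
    simp only [Finset.mem_biUnion, List.mem_toFinset, Finset.mem_image, Finset.mem_erase]
    exact ⟨u, hu, w, ⟨fun h => by simp [h, hv] at hc, hw⟩, by simp [hc]⟩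
  have hcard := (Finset.card_le_card hsub).trans
    (Finset.card_biUnion_le_card_mul _ _ D fun u hu => ?_)
  · have h1 := (adj v).toFinset_card_le
    have h2 := hD v
    have : (adj v).toFinset.card * D ≤ D * D := Nat.mul_le_mul_right _ (h1.trans h2)
    simp only [Finset.card_univ, Fintype.card_fin] at hcard
    nlinarith
  · refine Finset.card_image_le.trans ?_
    have hmem : v ∈ (u :: adj u).toFinset := by
      simp [hs _ _ (List.mem_toFinset.1 hu)]
    rw [Finset.card_erase_of_mem hmem]
    have h1 := (u :: adj u).toFinset_card_le
    have h2 := hD u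
    simp only [List.length_cons] at h1
    omega

/-- Invariant of the greedy loop: the partial coloring separates vertices at distance at most two,
and the vertices still on the list are uncolored. -/
lemma greedyLoop_spec {adj : Fin r → List (Fin r)} {D : ℕ}
    (hs : ∀ v w, w ∈ adj v → v ∈ adj w) (hD : ∀ v, (adj v).length ≤ D)
    (l : List (Fin r)) (hl : l.Nodup) (col : Fin r → Option (Fin (D ^ 2 + 1)))
    (hlc : ∀ v ∈ l, col v = none)
    (hcol : ∀ v w c, NearAdj adj v w → col v = some c → col w ≠ some c) :
    (∀ v w c, NearAdj adj v w → (greedyLoop (D ^ 2) adj l col).val v = some c →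
        (greedyLoop (D ^ 2) adj l col).val w ≠ some c) ∧
      (∀ v, (v ∈ l ∨ col v ≠ none) → (greedyLoop (D ^ 2) adj l col).val v ≠ none) ∧
      (greedyLoop (D ^ 2) adj l col).steps ≤ l.length * (6 * D ^ 2 + 4 * D + 7) + 1 := by
  induction l generalizing col with
  | nil => exact ⟨hcol, fun v hv => by simpa [greedyLoop] using hv, by simp [greedyLoop]⟩
  | cons v l ih =>
    obtain ⟨hm, hms⟩ := markBalls_spec adj col hD (adj v) fun _ => false
    simp only [Bool.false_eq_true, false_or] at hm
    set mark := (markBalls adj col (adj v) fun _ => false).val with hmark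
    obtain ⟨hf, hfs⟩ := firstFree_spec (D ^ 2) mark
    set c := (firstFree (D ^ 2) mark).val with hc
    have hfree : ¬ ∃ u ∈ adj v, ∃ w ∈ u :: adj u, col w = some c := by
      rw [← hm, Bool.not_eq_true]
      obtain ⟨d, hd⟩ := exists_unblocked hs hD col v (hlc v List.mem_cons_self)
      exact hf ⟨d, by rwa [← Bool.not_eq_true, hm]⟩
    have hnod := List.nodup_cons.1 hl
    have hcol' : ∀ x y d, NearAdj adj x y → Function.update col v (some c) x = some d →
        Function.update col v (some c) y ≠ some d := by
      intro x y d hxy hx hy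
      by_cases hxv : x = v
      · subst hxv
        rw [Function.update_self] at hx
        rw [Function.update_of_ne hxy.1.symm] at hy
        obtain ⟨-, u, hu, hw⟩ := hxy
        exact hfree ⟨u, hu, y, hw, hy.trans hx.symm⟩
      · rw [Function.update_of_ne hxv] at hx
        by_cases hyv : y = v
        · subst hyv
          rw [Function.update_self] at hy
          obtain ⟨-, u, hu, hw⟩ := hxy.symm hs
          exact hfree ⟨u, hu, x, hw, hx.trans hy.symm⟩
        · rw [Function.update_of_ne hyv] at hy
          exact hcol x y d hxy hx hy
    obtain ⟨i1, i2, i3⟩ := ih hnod.2 (Function.update col v (some c)) (fun w hw => by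
      rw [Function.update_of_ne (by rintro rfl; exact hnod.1 hw)]
      exact hlc w (List.mem_cons_of_mem _ hw)) hcol'
    have e : (greedyLoop (D ^ 2) adj (v :: l) col).val =
        (greedyLoop (D ^ 2) adj l (Function.update col v (some c))).val := rfl
    rw [e]
    refine ⟨i1, fun w hw => i2 w ?_, ?_⟩
    · by_cases hwv : w = v
      · right; simp [hwv]
      · rw [Function.update_of_ne hwv]
        simpa [hwv] using hw
    · have hb : (tabulate fun _ : Fin (D ^ 2 + 1) => op false).steps ≤ (D ^ 2 + 1) * (1 + 1) :=
        steps_tabulate_le _ fun _ => le_rfl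
      have hadj : (adj v).length * (2 * D + 4) ≤ D * (2 * D + 4) :=
        Nat.mul_le_mul_right _ (hD v)
      have e' : (greedyLoop (D ^ 2) adj (v :: l) col).steps =
          (tabulate fun _ : Fin (D ^ 2 + 1) => op false).steps +
          ((markBalls adj col (adj v) fun _ => false).steps +
          ((firstFree (D ^ 2) mark).steps +
          (1 + (greedyLoop (D ^ 2) adj l (Function.update col v (some c))).steps))) := rfl
      rw [e', List.length_cons]
      nlinarith

/-- With symmetric adjacency lists of length at most `D`, the `D ^ 2 + 1` colors always leave a free
one, so vertices at distance at most two get different colors. -/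
lemma graphColor_spec {adj : Fin r → List (Fin r)} {D : ℕ}
    (hs : ∀ v w, w ∈ adj v → v ∈ adj w) (hD : ∀ v, (adj v).length ≤ D) :
    (∀ v w, NearAdj adj v w →
      (graphColor (D ^ 2) adj).val v ≠ (graphColor (D ^ 2) adj).val w) ∧
      (graphColor (D ^ 2) adj).steps ≤ r * (6 * D ^ 2 + 4 * D + 9) + 1 := by
  obtain ⟨h1, h2, h3⟩ := greedyLoop_spec hs hD (List.finRange r) (List.nodup_finRange r)
    (fun _ => none) (fun _ _ => rfl) (fun _ _ _ _ h => by simp at h)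
  have e : (graphColor (D ^ 2) adj).steps =
      (greedyLoop (D ^ 2) adj (List.finRange r) fun _ => none).steps +
      (tabulate fun v => op
        (((greedyLoop (D ^ 2) adj (List.finRange r) fun _ => none).val v).getD 0)).steps := rfl
  have ev : ∀ v, (graphColor (D ^ 2) adj).val v =
      ((greedyLoop (D ^ 2) adj (List.finRange r) fun _ => none).val v).getD 0 := fun _ => rfl
  refine ⟨fun v w hvw heq => ?_, ?_⟩
  · obtain ⟨c, hc⟩ := Option.ne_none_iff_exists'.1 (h2 v (Or.inl (List.mem_finRange v)))
    obtain ⟨d, hd⟩ := Option.ne_none_iff_exists'.1 (h2 w (Or.inl (List.mem_finRange w)))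
    rw [ev, ev, hc, hd] at heq
    simp only [Option.getD_some] at heq
    exact h1 v w c hvw hc (heq ▸ hd)
  · have ht := steps_tabulate_le (c := 1) (fun v => op
      (((greedyLoop (D ^ 2) adj (List.finRange r) fun _ => none).val v).getD 0)) fun _ => le_rfl
    rw [List.length_finRange] at h3
    rw [e]
    nlinarith

end Coloring

section InteractionGraph

variable {n r : ℕ} (P : Fin r → PauliString n)

lemma mem_adjList {i j : Fin r} : j ∈ adjList P i ↔ (interactionGraph P).Adj i j := by
  simp [adjList]

lemma length_adjList_le (i : Fin r) :
    (adjList P i).length ≤ (interactionGraph P).maxDegree := by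
  refine le_trans (le_of_eq ?_) ((interactionGraph P).degree_le_maxDegree i)
  have hn : (adjList P i).Nodup := (List.nodup_finRange r).filter _
  rw [← List.toFinset_card_of_nodup hn, ← SimpleGraph.card_neighborFinset_eq_degree]
  congr 1
  ext j
  simp [mem_adjList]

lemma nearAdj_of_squaredGraph {i k : Fin r} (h : (squaredGraph P).Adj i k) :
    NearAdj (adjList P) i k := by
  obtain ⟨hne, j, hij, hjk⟩ := h
  refine ⟨hne, ?_⟩
  by_cases h1 : i = j
  · subst h1
    exact ⟨k, (mem_adjList P).2 ⟨hne, hjk⟩, List.mem_cons_self⟩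
  · refine ⟨j, (mem_adjList P).2 ⟨h1, hij⟩, ?_⟩
    by_cases h2 : k = j
    · exact h2 ▸ List.mem_cons_self
    · exact List.mem_cons_of_mem _ ((mem_adjList P).2 ⟨Ne.symm h2, hjk⟩)

lemma graphColor_proper {D : ℕ} (hD : (interactionGraph P).maxDegree = D) :
    (∀ i j, (squaredGraph P).Adj i j →
      (graphColor (D ^ 2) (adjList P)).val i ≠ (graphColor (D ^ 2) (adjList P)).val j) ∧
      (graphColor (D ^ 2) (adjList P)).steps ≤ r * (6 * D ^ 2 + 4 * D + 9) + 1 := by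
  obtain ⟨h1, h2⟩ := graphColor_spec (adj := adjList P) (D := D)
    (fun v w h => (mem_adjList P).2 ((mem_adjList P).1 h).symm)
    (fun v => hD ▸ length_adjList_le P v)
  exact ⟨fun i j h => h1 i j (nearAdj_of_squaredGraph P h), h2⟩

end InteractionGraph

/-! ### Chebyshev regression of the derivative at the left endpoint -/

section Regression

open Polynomial

lemma chebNodeT_val (L : ℕ) (l : Fin L) : (chebNodeT L l).val = chebNode L l := rfl

lemma chebPairT_spec (z : ℝ) (m : ℕ) :
    (chebPairT z m).val = ((Chebyshev.T ℝ m).eval z, (Chebyshev.T ℝ (m + 1)).eval z) ∧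
      (chebPairT z m).steps = 4 * m + 1 := by
  induction m with
  | zero => simp [chebPairT]
  | succ m ih =>
    simp only [chebPairT, val_bind, val_op, steps_bind, steps_op, ih.1, ih.2]
    refine ⟨?_, by ring⟩
    push_cast
    rw [show (m : ℤ) + 1 + 1 = m + 2 by ring, Chebyshev.T_add_two]
    simp

/-- The coefficient of the observation at the node `z_l` in the estimate of the derivative at the
left endpoint `-1` of `[-1, 1]`. -/
noncomputable def chebWeight (L : ℕ) (l : Fin L) : ℝ :=
  -∑ m ∈ Finset.Icc 1 (L - 1),
    (if Even m then (1 : ℝ) else -1) * (m : ℝ) ^ 2 *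
      (2 / L * (Chebyshev.T ℝ m).eval (chebNode L l))

lemma derivativeT_val (A : ℝ) {L : ℕ} (y : Fin L → ℝ) :
    (derivativeT A y).val = ∑ l, 2 / A * chebWeight L l * y l := by
  simp only [derivativeT, chebCoeffT, chebWeight, val_bind, val_op, val_sum,
    (chebPairT_spec _ _).1, chebNodeT_val, Finset.mul_sum, Finset.sum_mul, ← Finset.sum_neg_distrib,
    mul_neg, neg_mul]
  rw [Finset.sum_comm]
  refine Finset.sum_congr rfl fun l _ => Finset.sum_congr rfl fun m _ => ?_
  ring

lemma derivativeT_steps (A : ℝ) {L : ℕ} (y : Fin L → ℝ) :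
    (derivativeT A y).steps ≤ L * (L * (4 * L + 11) + 8) + 3 := by
  have hc : ∀ m ∈ Finset.Icc 1 (L - 1), (chebCoeffT y m).steps ≤ L * (4 * L + 11) + 2 := by
    intro m hm
    have hm' := Finset.mem_Icc.1 hm
    have h := steps_sum_le (c := 4 * L + 9) Finset.univ (fun l => do
      let z ← chebNodeT L l
      let p ← chebPairT z m
      op (y l * p.1)) fun l _ => by
        have : (chebNodeT L l).steps = 7 := rfl
        simp only [steps_bind, steps_op, (chebPairT_spec _ _).2, this]
        omega
    rw [Finset.card_univ, Fintype.card_fin] at h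
    simp only [chebCoeffT, steps_bind, steps_op]
    have h' : L * (4 * L + 9 + 2) = L * (4 * L + 11) := rfl
    omega
  have h := steps_sum_le (c := L * (4 * L + 11) + 6) (Finset.Icc 1 (L - 1)) (fun m => do
      let b ← chebCoeffT y m
      let e ← op (if Even m then (1 : ℝ) else -1)
      let q ← op ((m : ℝ) * (m : ℝ))
      let b ← op (b * q)
      op (e * b)) fun m hm => by
        have := hc m hm
        simp only [steps_bind, steps_op]
        omega
  rw [Nat.card_Icc] at h
  have h2 : (L - 1 + 1 - 1) * (L * (4 * L + 11) + 6 + 2) ≤ L * (L * (4 * L + 11) + 8) :=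
    Nat.mul_le_mul_right _ (by omega)
  simp only [derivativeT, steps_bind, steps_op]
  omega

lemma abs_chebNode_le (L : ℕ) (l : Fin L) : |chebNode L l| ≤ 1 := by
  rw [chebNode, abs_neg]
  exact Real.abs_cos_le_one _

lemma abs_chebWeight_le (L : ℕ) (l : Fin L) : |chebWeight L l| ≤ 2 * (L : ℝ) ^ 2 := by
  have hL : (0 : ℝ) < L := by exact_mod_cast l.pos
  rw [chebWeight, abs_neg]
  refine (Finset.abs_sum_le_sum_abs _ _).trans ?_
  have h : ∀ m ∈ Finset.Icc 1 (L - 1), |(if Even m then (1 : ℝ) else -1) * (m : ℝ) ^ 2 *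
      (2 / L * (Chebyshev.T ℝ m).eval (chebNode L l))| ≤ 2 * (L : ℝ) := by
    intro m hm
    have hm' := Finset.mem_Icc.1 hm
    have hmL : (m : ℝ) ≤ L := by exact_mod_cast (by omega : m ≤ L)
    have hT := Chebyshev.abs_eval_T_real_le_one m (abs_chebNode_le L l)
    have h1 : |(if Even m then (1 : ℝ) else -1)| = 1 := by split_ifs <;> simp
    rw [abs_mul, abs_mul, h1, abs_mul, abs_of_nonneg (by positivity : (0 : ℝ) ≤ 2 / L),
      abs_of_nonneg (by positivity : (0 : ℝ) ≤ (m : ℝ) ^ 2), one_mul]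
    calc (m : ℝ) ^ 2 * (2 / L * |(Chebyshev.T ℝ m).eval (chebNode L l)|)
        ≤ (L : ℝ) ^ 2 * (2 / L * 1) := by gcongr
      _ = 2 * (L : ℝ) := by field_simp
  refine (Finset.sum_le_card_nsmul _ _ _ h).trans ?_
  rw [Nat.card_Icc, nsmul_eq_mul]
  have : ((L - 1 + 1 - 1 : ℕ) : ℝ) ≤ L := by exact_mod_cast (by omega : L - 1 + 1 - 1 ≤ L)
  nlinarith

/-- The nodes are, up to sign, the zeros of `T_L`, where the sum of `T_k` vanishes. -/
lemma sum_chebNode_T {L : ℕ} {k : ℤ} (hk : ¬ (2 * L : ℤ) ∣ k) :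
    ∑ l : Fin L, (Chebyshev.T ℝ k).eval (chebNode L l) = 0 := by
  rcases Nat.eq_zero_or_pos L with rfl | hL
  · simp
  have h := Chebyshev.sumZeroes_T_of_not_dvd hk
  rw [Chebyshev.sumZeroes, mul_eq_zero_iff_left (by positivity)] at h
  rw [Finset.sum_range] at h
  simp only [chebNode, Chebyshev.T_eval_neg, ← Finset.mul_sum]
  rw [h, mul_zero]

/-- Discrete orthogonality of the Chebyshev polynomials on the nodes. -/
lemma sum_chebNode_T_mul_T {L m k : ℕ} (hm : m ∈ Finset.Icc 1 (L - 1)) (hk : k < L) :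
    2 / (L : ℝ) * ∑ l : Fin L, (Chebyshev.T ℝ m).eval (chebNode L l) *
      (Chebyshev.T ℝ k).eval (chebNode L l) = if m = k then 1 else 0 := by
  have hm' := Finset.mem_Icc.1 hm
  have hL : (L : ℝ) ≠ 0 := by exact_mod_cast (by omega : L ≠ 0)
  have h : ∀ l : Fin L, (Chebyshev.T ℝ m).eval (chebNode L l) *
      (Chebyshev.T ℝ k).eval (chebNode L l) =
      1 / 2 * ((Chebyshev.T ℝ (m + k)).eval (chebNode L l) +
        (Chebyshev.T ℝ (m - k)).eval (chebNode L l)) := by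
    intro l
    have := congrArg (Polynomial.eval (chebNode L l)) (Chebyshev.T_mul_T ℝ m k)
    simp only [eval_mul, eval_add, eval_ofNat] at this
    linarith
  simp only [h]
  rw [← Finset.mul_sum, Finset.sum_add_distrib, sum_chebNode_T]
  · split_ifs with hmk
    · subst hmk
      simp
      field_simp
    · rw [sum_chebNode_T]
      · simp
      · intro hd
        have := Int.eq_zero_of_abs_lt_dvd hd (by rw [abs_lt]; omega)
        omega
  · intro hd
    have := Int.le_of_dvd (by omega) hd
    omega

lemma X_pow_mem_span_T (k : ℕ) :
    (X ^ k : ℝ[X]) ∈ Submodule.span ℝ ((fun j : ℕ => Chebyshev.T ℝ j) '' Set.Iic k) := by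
  induction k with
  | zero => exact Submodule.subset_span ⟨0, by simp, by simp⟩
  | succ k ih =>
    have hle : Submodule.span ℝ ((fun j : ℕ => Chebyshev.T ℝ j) '' Set.Iic k) ≤
        (Submodule.span ℝ ((fun j : ℕ => Chebyshev.T ℝ j) '' Set.Iic (k + 1))).comap
          (LinearMap.mulLeft ℝ X) := by
      rw [Submodule.span_le]
      rintro _ ⟨j, hj, rfl⟩
      have hj : j ≤ k := hj
      simp only [Submodule.comap_coe, Set.mem_preimage, LinearMap.mulLeft_apply, SetLike.mem_coe]
      rcases j with _ | j
      · exact Submodule.subset_span ⟨1, by simp, by simp⟩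
      · have e : (X : ℝ[X]) * Chebyshev.T ℝ ((j + 1 : ℕ) : ℤ) =
            (1 / 2 : ℝ) • (Chebyshev.T ℝ ((j + 2 : ℕ) : ℤ) + Chebyshev.T ℝ (j : ℤ)) := by
          push_cast
          rw [Chebyshev.T_add_two, sub_add_cancel, mul_assoc, smul_eq_C_mul, ← mul_assoc,
            ← mul_assoc]
          congr 1
          rw [← map_ofNat (C : ℝ →+* ℝ[X]) 2, ← C_mul]
          norm_num
        rw [e]
        refine Submodule.smul_mem _ _ (Submodule.add_mem _ ?_ ?_)
        · exact Submodule.subset_span ⟨j + 2, Set.mem_Iic.2 (by omega), rfl⟩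
        · exact Submodule.subset_span ⟨j, Set.mem_Iic.2 (by omega), rfl⟩
    have := hle ih
    rwa [Submodule.mem_comap, LinearMap.mulLeft_apply, ← pow_succ'] at this

/-- The derivative estimate is exact on polynomials of degree less than the number of nodes: by
discrete orthogonality it maps `T_k` to `T_k'(-1) = (-1)^{k+1} k²`. -/
lemma sum_chebWeight_mul_eval {L : ℕ} (p : ℝ[X]) (hp : p.natDegree < L) :
    ∑ l, chebWeight L l * p.eval (chebNode L l) = (derivative p).eval (-1) := by
  let Φ : ℝ[X] →ₗ[ℝ] ℝ := ∑ l, chebWeight L l • leval (chebNode L l)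
  let Ψ : ℝ[X] →ₗ[ℝ] ℝ := (leval (-1 : ℝ)) ∘ₗ derivative
  have hT : ∀ k : ℕ, k < L → Φ (Chebyshev.T ℝ k) = Ψ (Chebyshev.T ℝ k) := by
    intro k hk
    have e : Φ (Chebyshev.T ℝ k) = -∑ m ∈ Finset.Icc 1 (L - 1),
        (if Even m then (1 : ℝ) else -1) * (m : ℝ) ^ 2 * (if m = k then 1 else 0) := by
      have h1 : Φ (Chebyshev.T ℝ k) =
          ∑ l, chebWeight L l * (Chebyshev.T ℝ k).eval (chebNode L l) := by
        simp [Φ, leval]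
      rw [h1]
      simp only [chebWeight, neg_mul, Finset.sum_neg_distrib, Finset.sum_mul]
      rw [Finset.sum_comm]
      congr 1
      refine Finset.sum_congr rfl fun m hm => ?_
      rw [← sum_chebNode_T_mul_T hm hk, Finset.mul_sum, Finset.mul_sum]
      exact Finset.sum_congr rfl fun l _ => by ring
    have e2 : Ψ (Chebyshev.T ℝ k) = -((if Even k then (1 : ℝ) else -1) * (k : ℝ) ^ 2) := by
      simp only [Ψ, LinearMap.comp_apply, leval_apply, Chebyshev.T_derivative_eq_U, eval_mul,
        Chebyshev.U_eval_neg_one]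
      rcases Nat.even_or_odd k with hk2 | hk2
      · have : ((k : ℤ) - 1).negOnePow = -1 := by
          rw [Int.negOnePow_sub, Int.negOnePow_one, Int.negOnePow_even _ (by exact_mod_cast hk2)]
          simp
        simp [this, hk2]; ring
      · have : ((k : ℤ) - 1).negOnePow = 1 := by
          rw [Int.negOnePow_sub, Int.negOnePow_one, Int.negOnePow_odd _ (by exact_mod_cast hk2)]
          simp
        simp [this, Nat.not_even_iff_odd.2 hk2]; ring
    rw [e, e2]
    congr 1
    rcases Nat.eq_zero_or_pos k with rfl | hk0
    · simp only [CharP.cast_eq_zero, ne_eq, OfNat.ofNat_ne_zero, not_false_eq_true, zero_pow,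
        mul_zero]
      refine Finset.sum_eq_zero fun m hm => ?_
      have := (Finset.mem_Icc.1 hm).1
      rw [if_neg (show m ≠ 0 by omega), mul_zero]
    · rw [Finset.sum_eq_single k]
      · simp
      · intro m _ hmk; simp [hmk]
      · intro h; exact absurd (Finset.mem_Icc.2 ⟨hk0, by omega⟩) h
  have hX : ∀ k : ℕ, k < L → Φ (X ^ k) = Ψ (X ^ k) := by
    intro k hk
    refine LinearMap.eqOn_span (s := (fun j : ℕ => Chebyshev.T ℝ j) '' Set.Iic k) ?_
      (X_pow_mem_span_T k)
    rintro _ ⟨j, hj, rfl⟩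
    exact hT j (lt_of_le_of_lt hj hk)
  have : Φ p = Ψ p := by
    rw [p.as_sum_range' L hp, map_sum, map_sum]
    refine Finset.sum_congr rfl fun k hk => ?_
    rw [← smul_X_eq_monomial, map_smul, map_smul, hX k (Finset.mem_range.1 hk)]
  simpa [Φ, Ψ, leval] using this

/-- The same exactness for polynomials on `[0, A]` instead of `[-1, 1]`, in terms of their
coefficients. -/
lemma sum_chebWeight_mul_taylor {L : ℕ} (hL : 2 ≤ L) {A : ℝ} (hA : A ≠ 0) (c : ℕ → ℝ) :
    ∑ l, 2 / A * chebWeight L l *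
      (∑ k ∈ Finset.range L, c k * (A / 2 * (1 + chebNode L l)) ^ k) = c 1 := by
  set p : ℝ[X] := ∑ k ∈ Finset.range L, C (c k) * (C (A / 2) * (1 + X)) ^ k with hp
  have hdeg : p.natDegree < L := by
    refine lt_of_le_of_lt (natDegree_sum_le_of_forall_le (n := L - 1) _ _ fun k hk => ?_)
      (by omega)
    have hk := Finset.mem_range.1 hk
    refine (natDegree_C_mul_le _ _).trans (natDegree_pow_le.trans ?_)
    have : (C (A / 2) * (1 + X) : ℝ[X]).natDegree ≤ 1 :=
      (natDegree_C_mul_le _ _).trans ((natDegree_add_le _ _).trans (by simp))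
    nlinarith [Nat.le_sub_one_of_lt hk]
  have h := sum_chebWeight_mul_eval p hdeg
  have e1 : ∀ l, p.eval (chebNode L l) =
      ∑ k ∈ Finset.range L, c k * (A / 2 * (1 + chebNode L l)) ^ k := by
    intro l
    simp [hp, eval_finsetSum]
  have e2 : (derivative p).eval (-1) = c 1 * (A / 2) := by
    simp only [hp, derivative_sum, eval_finsetSum]
    rw [Finset.sum_eq_single 1]
    · simp
    · intro k _ hk
      rcases k with _ | _ | k
      · simp
      · exact absurd rfl hk
      · simp [derivative_pow]
    · intro h; exact absurd (Finset.mem_range.2 (by omega)) h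
  simp only [e1, e2] at h
  calc _ = 2 / A * ∑ l, chebWeight L l *
      (∑ k ∈ Finset.range L, c k * (A / 2 * (1 + chebNode L l)) ^ k) := by
        rw [Finset.mul_sum]; exact Finset.sum_congr rfl fun l _ => by ring
    _ = c 1 := by rw [h]; field_simp

end Regression

/-! ### Tensor products of site operators -/

section SiteTensor

open Matrix

variable {n : ℕ}

lemma siteTensor_mul (M M' : Fin n → Matrix (Fin 2) (Fin 2) ℂ) :
    siteTensor M * siteTensor M' = siteTensor fun q => M q * M' q := by
  ext a b
  simp only [Matrix.mul_apply, siteTensor]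
  rw [Finset.prod_univ_sum, Fintype.piFinset_univ]
  exact Finset.sum_congr rfl fun c _ => Finset.prod_mul_distrib.symm

lemma siteTensor_one : siteTensor (fun _ : Fin n => (1 : Matrix (Fin 2) (Fin 2) ℂ)) = 1 := by
  ext a b
  simp only [siteTensor, Matrix.one_apply, Finset.prod_ite_zero]
  simp [funext_iff]

lemma siteTensor_conjTranspose (M : Fin n → Matrix (Fin 2) (Fin 2) ℂ) :
    (siteTensor M)ᴴ = siteTensor fun q => (M q)ᴴ := by
  ext a b
  simp [siteTensor, Matrix.conjTranspose_apply]

lemma siteTensor_trace (M : Fin n → Matrix (Fin 2) (Fin 2) ℂ) :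
    (siteTensor M).trace = ∏ q, (M q).trace := by
  simp only [Matrix.trace, Matrix.diag, siteTensor]
  rw [Finset.prod_univ_sum, Fintype.piFinset_univ]

lemma siteTensor_smul (c : Fin n → ℂ) (M : Fin n → Matrix (Fin 2) (Fin 2) ℂ) :
    siteTensor (fun q => c q • M q) = (∏ q, c q) • siteTensor M := by
  ext a b
  simp [siteTensor, Finset.prod_mul_distrib]

lemma sum_siteTensor {ι : Type*} [Fintype ι] [DecidableEq ι]
    (M : Fin n → ι → Matrix (Fin 2) (Fin 2) ℂ) :
    ∑ s : Fin n → ι, siteTensor (fun q => M q (s q)) = siteTensor fun q => ∑ i, M q i := by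
  ext a b
  simp only [siteTensor, Matrix.sum_apply]
  rw [Finset.prod_univ_sum, Fintype.piFinset_univ]

open scoped ComplexOrder MatrixOrder Matrix.Norms.L2Operator in
lemma siteTensor_posSemidef (M : Fin n → Matrix (Fin 2) (Fin 2) ℂ) (h : ∀ q, (M q).PosSemidef) :
    (siteTensor M).PosSemidef := by
  choose B hB using fun q => CStarAlgebra.nonneg_iff_eq_star_mul_self.1 (h q).nonneg
  have : siteTensor M = (siteTensor B)ᴴ * siteTensor B := by
    rw [siteTensor_conjTranspose, siteTensor_mul]
    exact congrArg _ (funext hB)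
  rw [this]
  exact posSemidef_conjTranspose_mul_self _

end SiteTensor

/-! ### The algebra of Pauli strings -/

section Pauli

open Matrix

variable {n : ℕ}

/-- The matrix of an element of `{I, σ_x, σ_y, σ_z}`. -/
def optMat : Option Axis → Matrix (Fin 2) (Fin 2) ℂ
  | none => 1
  | some a => a.mat

lemma pauliOp_eq (P : PauliString n) : pauliOp P = siteTensor fun q => optMat (P q) := by
  unfold pauliOp
  congr 1

/-- The product of two elements of `{I, σ_x, σ_y, σ_z}` without its phase. -/
def optMul : Option Axis → Option Axis → Option Axis
  | none, b => b
  | a, none => a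
  | some .x, some .x => none
  | some .x, some .y => some .z
  | some .x, some .z => some .y
  | some .y, some .x => some .z
  | some .y, some .y => none
  | some .y, some .z => some .x
  | some .z, some .x => some .y
  | some .z, some .y => some .x
  | some .z, some .z => none

/-- The phase of the product of two elements of `{I, σ_x, σ_y, σ_z}`. -/
noncomputable def optPhase : Option Axis → Option Axis → ℂ
  | some .x, some .y => Complex.I
  | some .y, some .z => Complex.I
  | some .z, some .x => Complex.I
  | some .y, some .x => -Complex.I
  | some .z, some .y => -Complex.I
  | some .x, some .z => -Complex.I
  | _, _ => 1

lemma norm_optPhase (a b : Option Axis) : ‖optPhase a b‖ = 1 := by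
  rcases a with _ | _ | _ | _ <;> rcases b with _ | _ | _ | _ <;> simp [optPhase]

lemma optMat_mul (a b : Option Axis) :
    optMat a * optMat b = optPhase a b • optMat (optMul a b) := by
  rcases a with _ | _ | _ | _ <;> rcases b with _ | _ | _ | _ <;>
    simp [optPhase, optMat, optMul, Axis.mat, Matrix.one_fin_two]

lemma optMat_comm (a b : Option Axis) :
    optMat a * optMat b = (if a ≠ none ∧ b ≠ none ∧ a ≠ b then (-1 : ℂ) else 1) •
      (optMat b * optMat a) := by
  rcases a with _ | _ | _ | _ <;> rcases b with _ | _ | _ | _ <;>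
    simp [optMat, Axis.mat]

lemma optMat_conjTranspose (a : Option Axis) : (optMat a)ᴴ = optMat a := by
  rcases a with _ | _ | _ | _
  · simp [optMat]
  all_goals
    ext i j
    fin_cases i <;> fin_cases j <;> simp [optMat, Axis.mat]

lemma optMat_mul_self (a : Option Axis) : optMat a * optMat a = 1 := by
  rcases a with _ | _ | _ | _ <;> simp [optMat, Axis.mat, Matrix.one_fin_two]

/-- The product of two Pauli strings without its phase. -/
def strMul (P Q : PauliString n) : PauliString n := fun q => optMul (P q) (Q q)

/-- The phase of the product of two Pauli strings. -/
noncomputable def strPhase (P Q : PauliString n) : ℂ := ∏ q, optPhase (P q) (Q q)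

lemma norm_strPhase (P Q : PauliString n) : ‖strPhase P Q‖ = 1 := by
  simp [strPhase, norm_prod, norm_optPhase]

lemma pauliOp_mul (P Q : PauliString n) :
    pauliOp P * pauliOp Q = strPhase P Q • pauliOp (strMul P Q) := by
  simp only [pauliOp_eq, siteTensor_mul, optMat_mul, siteTensor_smul, strPhase, strMul]

/-- The sites at which two Pauli strings anticommute. -/
def antiSites (P Q : PauliString n) : Finset (Fin n) :=
  Finset.univ.filter fun q => P q ≠ none ∧ Q q ≠ none ∧ P q ≠ Q q

/-- Pauli strings commute or anticommute according to the parity of the number of sites at which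
they anticommute. -/
lemma pauliOp_comm (P Q : PauliString n) :
    pauliOp P * pauliOp Q = (-1 : ℂ) ^ (antiSites P Q).card • (pauliOp Q * pauliOp P) := by
  simp only [pauliOp_eq, siteTensor_mul]
  rw [show (fun q => optMat (P q) * optMat (Q q)) = fun q =>
    (if P q ≠ none ∧ Q q ≠ none ∧ P q ≠ Q q then (-1 : ℂ) else 1) •
      (optMat (Q q) * optMat (P q)) from funext fun q => optMat_comm _ _, siteTensor_smul]
  congr 1
  rw [Finset.prod_ite, Finset.prod_const_one, mul_one, Finset.prod_const]
  rfl

lemma pauliOp_commute {P Q : PauliString n} (h : Even (antiSites P Q).card) :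
    pauliOp P * pauliOp Q = pauliOp Q * pauliOp P := by
  rw [pauliOp_comm, h.neg_one_pow, one_smul]

lemma pauliOp_anticommute {P Q : PauliString n} (h : Odd (antiSites P Q).card) :
    pauliOp P * pauliOp Q = -(pauliOp Q * pauliOp P) := by
  rw [pauliOp_comm, h.neg_one_pow, neg_one_smul]

lemma pauliOp_conjTranspose (P : PauliString n) : (pauliOp P)ᴴ = pauliOp P := by
  simp only [pauliOp_eq, siteTensor_conjTranspose, optMat_conjTranspose]

lemma pauliOp_mul_self (P : PauliString n) : pauliOp P * pauliOp P = 1 := by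
  simp only [pauliOp_eq, siteTensor_mul, optMat_mul_self, siteTensor_one]

lemma mem_supp {P : PauliString n} {q : Fin n} : q ∈ supp P ↔ P q ≠ none := by
  simp [supp]

lemma pauliOp_commute_of_disjoint {P Q : PauliString n} (h : Disjoint (supp P) (supp Q)) :
    pauliOp P * pauliOp Q = pauliOp Q * pauliOp P := by
  apply pauliOp_commute
  have : antiSites P Q = ∅ := by
    refine Finset.filter_eq_empty_iff.2 fun q _ hq => ?_
    exact Finset.disjoint_left.1 h (mem_supp.2 hq.1) (mem_supp.2 hq.2.1)
  simp [this]

lemma supp_strMul_subset (P Q : PauliString n) : supp (strMul P Q) ⊆ supp P ∪ supp Q := by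
  intro q hq
  rw [mem_supp] at hq
  rw [Finset.mem_union, mem_supp, mem_supp]
  by_contra! h
  simp [strMul, h.1, h.2, optMul] at hq

/-- Conjugation by an involution `U` that anticommutes with `X` and commutes with `ρ` changes the
sign of `Tr (X ρ)`. -/
lemma trace_mul_eq_zero_of_anticommute {U X ρ : Operator n} (hU : U * U = 1)
    (hX : U * X = -(X * U)) (hρ : U * ρ = ρ * U) : (X * ρ).trace = 0 := by
  have h : (X * ρ).trace = -(X * ρ).trace := by
    calc (X * ρ).trace = (U * U * (X * ρ)).trace := by rw [hU, one_mul]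
      _ = (U * (X * ρ) * U).trace := by rw [mul_assoc, Matrix.trace_mul_comm]
      _ = -(X * ρ * (U * U)).trace := by
        rw [← mul_assoc, hX, neg_mul, neg_mul, Matrix.trace_neg, mul_assoc X U ρ, hρ]
        simp only [mul_assoc]
      _ = _ := by rw [hU, mul_one]
  exact self_eq_neg.1 h

end Pauli

/-! ### States -/

section State

open Matrix

open scoped ComplexOrder

variable {n : ℕ}

/-- Density matrices. -/
def IsState (ρ : Operator n) : Prop := ρ.PosSemidef ∧ ρ.trace = 1

/-- Positivity of the Born rule for a projection `B`. -/
lemma trace_mul_nonneg {B ρ : Operator n} (hρ : ρ.PosSemidef) (hB : Bᴴ * B = B) :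
    0 ≤ (B * ρ).trace := by
  have := (hρ.mul_mul_conjTranspose_same B).trace_nonneg
  rwa [Matrix.trace_mul_comm, ← mul_assoc, hB] at this

/-- The expectation of a Pauli string lies in `[-1, 1]` because `(1 ± W) / 2` are projections. -/
lemma IsState.norm_trace_pauliOp_le {ρ : Operator n} (hρ : IsState ρ) (W : PauliString n) :
    ‖(pauliOp W * ρ).trace‖ ≤ 1 := by
  have key : ∀ c : ℂ, c = 1 ∨ c = -1 → 0 ≤ 1 + c * (pauliOp W * ρ).trace := by
    intro c hc
    have hcc : c * c = 1 := by rcases hc with rfl | rfl <;> simp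
    have hcs : star c = c := by rcases hc with rfl | rfl <;> simp
    have := trace_mul_nonneg hρ.1 (B := (1 / 2 : ℂ) • (1 + c • pauliOp W)) (by
      rw [conjTranspose_smul, conjTranspose_add, conjTranspose_smul, pauliOp_conjTranspose,
        conjTranspose_one, hcs]
      have : (1 + c • pauliOp W) * (1 + c • pauliOp W) = (2 : ℂ) • (1 + c • pauliOp W) := by
        simp only [add_mul, mul_add, one_mul, mul_one, smul_mul_smul_comm, hcc, pauliOp_mul_self]
        rw [one_smul, two_smul]
        abel
      rw [smul_mul_smul_comm, this, smul_smul]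
      simp)
    rw [smul_mul_assoc, add_mul, one_mul, Matrix.trace_smul, Matrix.trace_add, hρ.2, smul_mul_assoc,
      Matrix.trace_smul, smul_eq_mul, smul_eq_mul] at this
    have h2 := mul_nonneg (show (0 : ℂ) ≤ 2 by norm_num) this
    rwa [← mul_assoc, show (2 : ℂ) * (1 / 2) = 1 by norm_num, one_mul] at h2
  obtain ⟨a1, a2⟩ := Complex.nonneg_iff.1 (key 1 (Or.inl rfl))
  obtain ⟨b1, -⟩ := Complex.nonneg_iff.1 (key (-1) (Or.inr rfl))
  simp only [one_mul, neg_mul, Complex.add_re, Complex.add_im, Complex.neg_re, Complex.one_re,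
    Complex.one_im, zero_add] at a1 a2 b1
  have e : (pauliOp W * ρ).trace = (((pauliOp W * ρ).trace.re : ℝ) : ℂ) :=
    Complex.ext rfl (by simp [← a2])
  rw [e, Complex.norm_real, Real.norm_eq_abs, abs_le]
  constructor <;> linarith

lemma hamiltonian_conjTranspose {r : ℕ} (P : Fin r → PauliString n) (θ : Fin r → ℝ) :
    (hamiltonian P θ)ᴴ = hamiltonian P θ := by
  simp [hamiltonian, conjTranspose_sum, conjTranspose_smul, pauliOp_conjTranspose]

lemma exp_mul_exp_neg (X : Operator n) : NormedSpace.exp X * NormedSpace.exp (-X) = 1 := by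
  rw [← Matrix.exp_add_of_commute _ _ (Commute.neg_right (Commute.refl X)), add_neg_cancel,
    NormedSpace.exp_zero]

lemma IsState.evolve {H ρ : Operator n} (hρ : IsState ρ) (hH : Hᴴ = H) (t : ℝ) :
    IsState (evolve H t ρ) := by
  have hU : NormedSpace.exp ((Complex.I * (t : ℂ)) • H) =
      (NormedSpace.exp ((-(Complex.I * (t : ℂ))) • H))ᴴ := by
    rw [← Matrix.exp_conjTranspose, conjTranspose_smul, hH]
    simp
  refine ⟨?_, ?_⟩
  · rw [HamLearn.evolve, hU]
    exact hρ.1.mul_mul_conjTranspose_same _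
  · rw [HamLearn.evolve, mul_assoc, Matrix.trace_mul_comm, mul_assoc, neg_smul, exp_mul_exp_neg,
      mul_one, hρ.2]

end State

/-! ### Time derivatives of expectation values -/

section Dynamics

open Matrix

variable {n : ℕ}

/-- The generator `X ↦ i [H, X]` of the Heisenberg evolution. -/
noncomputable def heisenberg (H : Operator n) : Operator n →ₗ[ℂ] Operator n :=
  Complex.I • (LinearMap.mulLeft ℂ H - LinearMap.mulRight ℂ H)

lemma heisenberg_apply (H X : Operator n) : heisenberg H X = Complex.I • (H * X - X * H) := rfl

/-- The Schrödinger derivative of `e^{-iHt} ρ e^{iHt}`, with `U` and `V` for the exponentials, is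
moved onto the observable `X` by cyclicity of the trace. -/
lemma trace_mul_generator (H ρ X U V : Operator n) :
    (X * (-Complex.I • H * U * ρ * V + U * ρ * (V * (Complex.I • H)))).trace =
      (heisenberg H X * (U * ρ * V)).trace := by
  rw [mul_add, Matrix.trace_add, heisenberg_apply, smul_mul_assoc Complex.I, sub_mul,
    Matrix.trace_smul, Matrix.trace_sub]
  have a1 : (X * (-Complex.I • H * U * ρ * V)).trace =
      -Complex.I * (X * H * (U * ρ * V)).trace := by
    rw [← smul_eq_mul (-Complex.I), ← Matrix.trace_smul]
    congr 1
    simp only [smul_mul_assoc, mul_smul_comm, mul_assoc]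
  have a2 : (X * (U * ρ * (V * (Complex.I • H)))).trace =
      Complex.I * (H * X * (U * ρ * V)).trace := by
    rw [← smul_eq_mul Complex.I, ← Matrix.trace_smul, mul_assoc H X, Matrix.trace_smul,
      Matrix.trace_mul_comm H, ← Matrix.trace_smul]
    congr 1
    simp only [mul_smul_comm, mul_assoc]
  rw [a1, a2, smul_eq_mul]
  ring

open scoped Matrix.Norms.Operator in
lemma hasDerivAt_trace_mul {M : ℝ → Operator n} {M' : Operator n} {t : ℝ}
    (h : HasDerivAt M M' t) (X : Operator n) :
    HasDerivAt (fun t => (X * M t).trace) (X * M').trace t :=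
  ((Matrix.traceLinearMap (Fin n → Fin 2) ℝ ℂ) ∘ₗ
    LinearMap.mulLeft ℝ X).toContinuousLinearMap.hasFDerivAt.comp_hasDerivAt t h

open scoped Matrix.Norms.Operator in
lemma hasDerivAt_trace_evolve (H ρ X : Operator n) (t : ℝ) :
    HasDerivAt (fun t => (X * evolve H t ρ).trace) (heisenberg H X * evolve H t ρ).trace t := by
  have e1 : ∀ s : ℝ, NormedSpace.exp ((-(Complex.I * (s : ℂ))) • H) =
      NormedSpace.exp (s • (-Complex.I • H)) := fun s => by
    congr 1
    rw [← Complex.coe_smul, smul_smul]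
    congr 1; ring
  have e2 : ∀ s : ℝ, NormedSpace.exp ((Complex.I * (s : ℂ)) • H) =
      NormedSpace.exp (s • (Complex.I • H)) := fun s => by
    congr 1
    rw [← Complex.coe_smul, smul_smul]
    congr 1; ring
  have h1 := hasDerivAt_exp_smul_const' (𝕂 := ℝ) (-Complex.I • H) t
  have h2 := hasDerivAt_exp_smul_const (𝕂 := ℝ) (Complex.I • H) t
  have h3 := (h1.mul_const ρ).mul h2
  refine ((hasDerivAt_trace_mul h3 X).congr_deriv ?_).congr_of_eventuallyEq
    (Filter.Eventually.of_forall fun s => ?_)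
  · simp only [evolve, e1, e2]
    exact trace_mul_generator H ρ X _ _
  · simp only [evolve, e1, e2]
    rfl

/-- Taylor's formula at zero for a function given together with its successive derivatives. -/
lemma norm_sub_taylor_le (L : ℕ) (F : ℕ → ℝ → ℂ) {C : ℝ}
    (hF : ∀ k t, HasDerivAt (F k) (F (k + 1) t) t) (hC : ∀ t, ‖F L t‖ ≤ C) {t : ℝ} (ht : 0 ≤ t) :
    ‖F 0 t - ∑ k ∈ Finset.range L, ((t ^ k / k.factorial : ℝ) : ℂ) * F k 0‖ ≤
      C * t ^ L / L.factorial := by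
  induction L generalizing F t with
  | zero => simpa using hC t
  | succ L ih =>
    have hder : ∀ s : ℝ, HasDerivAt (fun s : ℝ => F 0 s - ∑ k ∈ Finset.range (L + 1),
        ((s ^ k / k.factorial : ℝ) : ℂ) * F k 0) (F 1 s - ∑ k ∈ Finset.range L,
        ((s ^ k / k.factorial : ℝ) : ℂ) * F (k + 1) 0) s := by
      intro s
      refine (hF 0 s).sub ?_
      simp only [Finset.sum_range_succ']
      have hk : ∀ k ∈ Finset.range L, HasDerivAt
          (fun s : ℝ => ((s ^ (k + 1) / (k + 1).factorial : ℝ) : ℂ) * F (k + 1) 0)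
          (((s ^ k / k.factorial : ℝ) : ℂ) * F (k + 1) 0) s := by
        intro k _
        have h := ((hasDerivAt_pow (k + 1) s).div_const ((k + 1).factorial : ℝ)).ofReal_comp
        convert! h.mul_const (F (k + 1) 0) using 2
        rw [Nat.factorial_succ]
        push_cast
        field_simp
      simpa using (HasDerivAt.fun_sum hk).add_const (F 0 0)
    have hB : ∀ s : ℝ, HasDerivAt (fun s : ℝ => C * s ^ (L + 1) / (L + 1).factorial)
        (C * s ^ L / L.factorial) s := by
      intro s
      convert! ((hasDerivAt_pow (L + 1) s).const_mul C).div_const ((L + 1).factorial : ℝ) using 1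
      rw [Nat.factorial_succ]
      push_cast
      field_simp
    refine image_norm_le_of_norm_deriv_right_le_deriv_boundary (a := 0) (b := t)
      (fun s _ => (hder s).continuousAt.continuousWithinAt)
      (fun s _ => (hder s).hasDerivWithinAt) ?_ hB ?_ ⟨ht, le_rfl⟩
    · simp [Finset.sum_range_succ']
    · intro s hs
      exact ih (fun k => F (k + 1)) (fun k t => hF (k + 1) t) hC hs.1

variable {r : ℕ} (P : Fin r → PauliString n) (θ : Fin r → ℝ)

/-- Only the terms that anticommute with the Pauli string `W` contribute to `i [H, W]`, each with a
single Pauli string. -/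
lemma heisenberg_pauliOp (W : PauliString n) :
    heisenberg (hamiltonian P θ) (pauliOp W) =
      ∑ j ∈ Finset.univ.filter (fun j => Odd (antiSites (P j) W).card),
        (2 * Complex.I * (θ j : ℂ) * strPhase (P j) W) • pauliOp (strMul (P j) W) := by
  rw [heisenberg_apply, hamiltonian, Finset.sum_mul, Finset.mul_sum, ← Finset.sum_sub_distrib,
    Finset.smul_sum, Finset.sum_filter]
  refine Finset.sum_congr rfl fun j _ => ?_
  rw [smul_mul_assoc, mul_smul_comm, ← smul_sub]
  split_ifs with h
  · rw [show pauliOp W * pauliOp (P j) = -(pauliOp (P j) * pauliOp W) by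
      rw [pauliOp_anticommute h, neg_neg], sub_neg_eq_add, ← two_smul ℂ, pauliOp_mul,
      smul_smul, smul_smul, smul_smul]
    congr 1; ring
  · rw [pauliOp_commute (Nat.not_odd_iff_even.1 h), sub_self, smul_zero, smul_zero]

/-- At most `m (D + 1)` terms fail to commute with an operator on the supports of `m` terms. -/
lemma card_odd_antiSites_le {D : ℕ} (hD : (interactionGraph P).maxDegree = D) (V : Finset (Fin r))
    (W : PauliString n) (hW : supp W ⊆ V.biUnion fun v => supp (P v)) :
    (Finset.univ.filter (fun j => Odd (antiSites (P j) W).card)).card ≤ V.card * (D + 1) := by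
  have hsub : Finset.univ.filter (fun j => Odd (antiSites (P j) W).card) ⊆
      V.biUnion fun v => insert v ((interactionGraph P).neighborFinset v) := by
    intro j hj
    obtain ⟨q, hq⟩ := Finset.card_pos.1 (Finset.mem_filter.1 hj).2.pos
    obtain ⟨hq1, hq2, -⟩ := (Finset.mem_filter.1 hq).2
    obtain ⟨v, hv, hqv⟩ := Finset.mem_biUnion.1 (hW (mem_supp.2 hq2))
    refine Finset.mem_biUnion.2 ⟨v, hv, ?_⟩
    rw [Finset.mem_insert, SimpleGraph.mem_neighborFinset]
    by_cases h : j = v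
    · exact Or.inl h
    · exact Or.inr ⟨Ne.symm h, q, Finset.mem_inter.2 ⟨hqv, mem_supp.2 hq1⟩⟩
  refine (Finset.card_le_card hsub).trans (Finset.card_biUnion_le_card_mul _ _ _ fun v _ => ?_)
  refine (Finset.card_insert_le _ _).trans ?_
  rw [SimpleGraph.card_neighborFinset_eq_degree]
  have := (interactionGraph P).degree_le_maxDegree v
  omega

/-- Each commutator with `H` enlarges the region occupied by an operator by the support of one
term, and a region made of `m` supports meets at most `m (D + 1)` terms. -/
lemma norm_trace_heisenberg_pow_le {D : ℕ} (hD : (interactionGraph P).maxDegree = D)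
    {ρ : Operator n} (hρ : IsState ρ) (k m : ℕ) (V : Finset (Fin r)) (hV : V.card ≤ m)
    (W : PauliString n) (hW : supp W ⊆ V.biUnion fun v => supp (P v)) :
    ‖((heisenberg (hamiltonian P θ) ^ k) (pauliOp W) * ρ).trace‖ ≤
      (2 * (D + 1) * ‖θ‖) ^ k * m.ascFactorial k := by
  induction k generalizing m V W with
  | zero => simpa using hρ.norm_trace_pauliOp_le W
  | succ k ih =>
    rw [pow_succ, Module.End.mul_apply, heisenberg_pauliOp, map_sum, Finset.sum_mul,
      Matrix.trace_sum]
    refine (norm_sum_le _ _).trans ((Finset.sum_le_card_nsmul _ _ (2 * ‖θ‖ *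
      ((2 * (D + 1) * ‖θ‖) ^ k * (m + 1).ascFactorial k)) fun j _ => ?_).trans ?_)
    · rw [map_smul, smul_mul_assoc, Matrix.trace_smul, norm_smul]
      have h1 : ‖2 * Complex.I * (θ j : ℂ) * strPhase (P j) W‖ ≤ 2 * ‖θ‖ := by
        simp only [norm_mul, norm_strPhase, Complex.norm_ofNat, Complex.norm_I, Complex.norm_real,
          mul_one]
        gcongr
        exact norm_le_pi_norm θ j
      refine mul_le_mul h1 (ih (m + 1) (insert j V) ?_ _ ?_) (norm_nonneg _) (by positivity)
      · exact (Finset.card_insert_le _ _).trans (by omega)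
      · rw [Finset.biUnion_insert]
        exact (supp_strMul_subset _ _).trans (Finset.union_subset_union_right hW)
    · have hc := (card_odd_antiSites_le P hD V W hW).trans (Nat.mul_le_mul_right (D + 1) hV)
      have hc' : ((Finset.univ.filter (fun j => Odd (antiSites (P j) W).card)).card : ℝ) ≤
          m * (D + 1) := by exact_mod_cast hc
      have ha : (m : ℝ) * ((m + 1).ascFactorial k : ℝ) = (m.ascFactorial (k + 1) : ℝ) := by
        rw [Nat.ascFactorial_succ, ← Nat.succ_ascFactorial]
        push_cast; rfl
      rw [nsmul_eq_mul]
      calc _ ≤ (m * (D + 1) : ℝ) * (2 * ‖θ‖ *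
            ((2 * (D + 1) * ‖θ‖) ^ k * (m + 1).ascFactorial k)) :=
            mul_le_mul_of_nonneg_right hc' (by positivity)
        _ = (2 * (D + 1) * ‖θ‖) ^ (k + 1) * (m * ((m + 1).ascFactorial k : ℝ)) := by ring
        _ = _ := by rw [ha]

lemma hasDerivAt_trace_heisenberg_pow (H ρ X : Operator n) (k : ℕ) (t : ℝ) :
    HasDerivAt (fun t => ((heisenberg H ^ k) X * evolve H t ρ).trace)
      ((heisenberg H ^ (k + 1)) X * evolve H t ρ).trace t := by
  rw [pow_succ', Module.End.mul_apply]
  exact hasDerivAt_trace_evolve H ρ _ t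

/-- The expectation value of a Pauli string inside the support of one term is given by its Taylor
polynomial at time zero, with a remainder that decays geometrically for times below
`1 / (2 (D + 1) ‖θ‖)`. -/
lemma norm_expectation_sub_taylor_le {D : ℕ} (hD : (interactionGraph P).maxDegree = D)
    {ρ : Operator n} (hρ : IsState ρ) {j : Fin r} {W : PauliString n} (hW : supp W ⊆ supp (P j))
    (L : ℕ) {t : ℝ} (ht : 0 ≤ t) :
    ‖(pauliOp W * evolve (hamiltonian P θ) t ρ).trace -
      ∑ k ∈ Finset.range L, ((t ^ k / k.factorial : ℝ) : ℂ) *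
        ((heisenberg (hamiltonian P θ) ^ k) (pauliOp W) * ρ).trace‖ ≤
      (2 * (D + 1) * ‖θ‖ * t) ^ L := by
  have h := norm_sub_taylor_le L
    (fun k t => ((heisenberg (hamiltonian P θ) ^ k) (pauliOp W) *
      evolve (hamiltonian P θ) t ρ).trace)
    (fun k t => hasDerivAt_trace_heisenberg_pow _ _ _ k t)
    (fun t => norm_trace_heisenberg_pow_le P θ hD
      (hρ.evolve (hamiltonian_conjTranspose P θ) t) L 1 {j} (by simp) W (by simpa using hW)) ht
  have e0 : evolve (hamiltonian P θ) 0 ρ = ρ := by simp [evolve]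
  simp only [e0, pow_zero, Module.End.one_apply, Nat.one_ascFactorial] at h
  refine h.trans (le_of_eq ?_)
  have : (L.factorial : ℝ) ≠ 0 := by exact_mod_cast L.factorial_ne_zero
  rw [mul_pow _ t L]
  field_simp

end Dynamics

/-! ### Products of commuting Pauli projections -/

section Stabilizer

open Matrix

variable {n : ℕ} {ι : Type*}

lemma sgn_mul_self (b : Bool) : ((sgn b : ℝ) : ℂ) * ((sgn b : ℝ) : ℂ) = 1 := by
  cases b <;> simp [sgn]

/-- The operator `∏ j, (1 ± Q_j)` over the indices `j` in a list, with the signs given by `s`. For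
commuting Pauli strings `Q_j` it is a multiple of the projection on the common eigenspace in which
`Q_j` has the eigenvalue `sgn (s j)`. -/
noncomputable def stabilizerOp (Q : ι → PauliString n) (s : ι → Bool) (l : List ι) : Operator n :=
  (l.map fun j => 1 + ((sgn (s j) : ℝ) : ℂ) • pauliOp (Q j)).prod

variable (Q : ι → PauliString n) (s : ι → Bool)

lemma stabilizerOp_cons (j : ι) (l : List ι) :
    stabilizerOp Q s (j :: l) =
      (1 + ((sgn (s j) : ℝ) : ℂ) • pauliOp (Q j)) * stabilizerOp Q s l := rfl

lemma pauliOp_comm_stabilizerOp (U : PauliString n) (l : List ι)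
    (h : ∀ i ∈ l, Even (antiSites U (Q i)).card) :
    pauliOp U * stabilizerOp Q s l = stabilizerOp Q s l * pauliOp U := by
  refine (Commute.list_prod_right _ _ fun x hx => ?_).eq
  obtain ⟨i, hi, rfl⟩ := List.mem_map.1 hx
  exact (Commute.one_right _).add_right
    (Commute.smul_right (pauliOp_commute (h i hi)) _)

lemma trace_pauliOp_mul_stabilizerOp_eq_zero (U W : PauliString n) (l : List ι)
    (hW : Odd (antiSites U W).card) (h : ∀ i ∈ l, Even (antiSites U (Q i)).card) :
    (pauliOp W * stabilizerOp Q s l).trace = 0 :=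
  trace_mul_eq_zero_of_anticommute (pauliOp_mul_self U) (pauliOp_anticommute hW)
    (pauliOp_comm_stabilizerOp Q s U l h)

lemma antiSites_single (q : Fin n) (b : Axis) (W : PauliString n) :
    antiSites (singlePauli q b) W = if W q ≠ none ∧ W q ≠ some b then {q} else ∅ := by
  ext q'
  simp only [antiSites, singlePauli]
  by_cases h : q' = q
  · subst h
    by_cases h1 : W q' = none <;> by_cases h2 : W q' = some b <;>
      simp [h1, h2, eq_comm]
  · split_ifs <;> simp [h]

lemma exists_axis_ne (b : Option Axis) : ∃ a : Axis, b ≠ some a := by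
  rcases b with _ | _ | _ | _
  exacts [⟨.x, by simp⟩, ⟨.y, by simp⟩, ⟨.x, by simp⟩, ⟨.x, by simp⟩]

variable {Q} {l : List ι}

/-- Expanding the product, every summand but the identity has trace zero. -/
lemma trace_stabilizerOp (hne : ∀ j ∈ l, (supp (Q j)).Nonempty)
    (hd : l.Pairwise fun i j => Disjoint (supp (Q i)) (supp (Q j))) :
    (stabilizerOp Q s l).trace = 2 ^ n := by
  induction l with
  | nil => simp [stabilizerOp]
  | cons j l ih =>
    rw [List.pairwise_cons] at hd
    rw [stabilizerOp_cons, add_mul, one_mul, Matrix.trace_add,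
      ih (fun i hi => hne i (List.mem_cons_of_mem _ hi)) hd.2, smul_mul_assoc, Matrix.trace_smul]
    obtain ⟨q, hq⟩ := hne j List.mem_cons_self
    obtain ⟨b, hb⟩ := exists_axis_ne (Q j q)
    rw [trace_pauliOp_mul_stabilizerOp_eq_zero Q s (singlePauli q b) (Q j) l, smul_zero, add_zero]
    · rw [antiSites_single, if_pos ⟨mem_supp.1 hq, hb⟩]; simp
    · intro i hi
      have : Q i q = none := by
        by_contra h
        exact Finset.disjoint_left.1 (hd.1 i hi) hq (mem_supp.2 h)
      rw [antiSites_single, if_neg (by simp [this])]; simp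

lemma smul_pauliOp_mul_stabilizerOp
    (hd : l.Pairwise fun i j => Disjoint (supp (Q i)) (supp (Q j))) {j : ι} (hj : j ∈ l) :
    (((sgn (s j) : ℝ) : ℂ) • pauliOp (Q j)) * stabilizerOp Q s l = stabilizerOp Q s l := by
  induction l with
  | nil => simp at hj
  | cons i l ih =>
    rw [List.pairwise_cons] at hd
    rw [stabilizerOp_cons]
    rcases List.mem_cons.1 hj with rfl | hj
    · rw [← mul_assoc, mul_add, mul_one, smul_mul_smul_comm, sgn_mul_self, pauliOp_mul_self,
        one_smul, add_comm]
    · have hc : (((sgn (s j) : ℝ) : ℂ) • pauliOp (Q j)) *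
          (1 + ((sgn (s i) : ℝ) : ℂ) • pauliOp (Q i)) =
          (1 + ((sgn (s i) : ℝ) : ℂ) • pauliOp (Q i)) *
          (((sgn (s j) : ℝ) : ℂ) • pauliOp (Q j)) := by
        rw [mul_add, add_mul, mul_one, one_mul, smul_mul_smul_comm, smul_mul_smul_comm,
          pauliOp_commute_of_disjoint (hd.1 j hj), mul_comm (((sgn (s j) : ℝ) : ℂ))]
      rw [← mul_assoc, hc, mul_assoc, ih hd.2 hj]

/-! ### Decomposition into product states -/

lemma siteState_trace (s : Option (Axis × Bool)) : (siteState s).trace = 1 := by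
  rcases s with _ | ⟨_ | _ | _, b⟩ <;>
    simp [siteState, Matrix.trace_fin_two, Axis.mat]

lemma sum_siteState (R : Option Axis) : ∑ b, siteState (R.map fun a => (a, b)) = 1 := by
  rcases R with _ | a
  · simp only [Option.map_none, siteState, Fintype.sum_bool, ← add_smul]
    norm_num
  · simp only [Option.map_some, siteState, Fintype.sum_bool, sgn, if_true, Bool.false_eq_true,
      if_false, Complex.ofReal_one, Complex.ofReal_neg]
    module

lemma optMat_mul_siteState (a R : Option Axis) (b : Bool) (h : a = none ∨ a = R) :
    optMat a * siteState (R.map fun a => (a, b)) =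
      (((if a = none then 1 else sgn b : ℝ)) : ℂ) • siteState (R.map fun a => (a, b)) := by
  rcases h with rfl | rfl
  · simp [optMat]
  · rcases a with _ | a
    · simp [optMat]
    · have h2 : a.mat * a.mat = 1 := optMat_mul_self (some a)
      simp only [Option.map_some, siteState, optMat, mul_smul_comm, mul_add, mul_one, h2,
        reduceCtorEq, if_false]
      rw [smul_comm _ (1 / 2 : ℂ), smul_add ((sgn b : ℝ) : ℂ), smul_smul ((sgn b : ℝ) : ℂ),
        sgn_mul_self, one_smul, add_comm]

lemma sum_productState (R : PauliString n) :
    ∑ σ : Fin n → Bool, productState (fun q => (R q).map fun a => (a, σ q)) = 1 := by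
  simp only [productState]
  rw [sum_siteTensor fun q b => siteState ((R q).map fun a => (a, b))]
  simp only [sum_siteState, siteTensor_one]

lemma productState_trace (s : Fin n → Option (Axis × Bool)) : (productState s).trace = 1 := by
  simp [productState, siteTensor_trace, siteState_trace]

/-- The eigenvalue of a Pauli string on the product of eigenstates with the signs `σ`. -/
noncomputable def eigenSign (W : PauliString n) (σ : Fin n → Bool) : ℝ :=
  ∏ q, if W q = none then 1 else sgn (σ q)

lemma abs_eigenSign (W : PauliString n) (σ : Fin n → Bool) : |eigenSign W σ| = 1 := by
  rw [eigenSign, Finset.abs_prod]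
  refine Finset.prod_eq_one fun q _ => ?_
  split_ifs
  · simp
  · cases σ q <;> simp [sgn]

lemma pauliOp_mul_productState (W R : PauliString n) (σ : Fin n → Bool)
    (h : ∀ q, W q = none ∨ W q = R q) :
    pauliOp W * productState (fun q => (R q).map fun a => (a, σ q)) =
      ((eigenSign W σ : ℝ) : ℂ) • productState (fun q => (R q).map fun a => (a, σ q)) := by
  simp only [pauliOp_eq, productState, siteTensor_mul, optMat_mul_siteState _ _ _ (h _),
    siteTensor_smul, eigenSign]
  push_cast
  rfl

lemma stabilizerOp_mul_productState (R : PauliString n) (σ : Fin n → Bool)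
    (h : ∀ j ∈ l, ∀ q, Q j q = none ∨ Q j q = R q) :
    stabilizerOp Q s l * productState (fun q => (R q).map fun a => (a, σ q)) =
      (((l.map fun j => 1 + sgn (s j) * eigenSign (Q j) σ).prod : ℝ) : ℂ) •
        productState (fun q => (R q).map fun a => (a, σ q)) := by
  induction l with
  | nil => simp [stabilizerOp]
  | cons j l ih =>
    rw [stabilizerOp_cons, mul_assoc, ih fun i hi => h i (List.mem_cons_of_mem _ hi),
      mul_smul_comm, add_mul, one_mul, smul_mul_assoc,
      pauliOp_mul_productState _ _ _ (h j List.mem_cons_self), smul_smul, List.map_cons,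
      List.prod_cons]
    push_cast
    module

/-- Pauli strings with disjoint supports are restrictions of one string. -/
lemma exists_common_string (hd : l.Pairwise fun i j => Disjoint (supp (Q i)) (supp (Q j))) :
    ∃ R : PauliString n, ∀ j ∈ l, ∀ q, Q j q = none ∨ Q j q = R q := by
  induction l with
  | nil => exact ⟨fun _ => none, by simp⟩
  | cons j l ih =>
    rw [List.pairwise_cons] at hd
    obtain ⟨R, hR⟩ := ih hd.2
    refine ⟨fun q => if Q j q = none then R q else Q j q, fun i hi q => ?_⟩
    rcases List.mem_cons.1 hi with rfl | hi
    · by_cases h : Q i q = none <;> simp [h]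
    · by_cases h : Q j q = none
      · simpa [h] using hR i hi q
      · left
        by_contra h'
        exact Finset.disjoint_left.1 (hd.1 i hi) (mem_supp.2 h) (mem_supp.2 h')

/-- `∏ j, (1 ± Q_j) / 2ⁿ` is a mixture of product states: on a product of eigenstates of the
single-site factors, every `1 ± Q_j` acts as a nonnegative
number, and the uniform mixture of all such products is the maximally mixed state. -/
lemma stabilizerOp_mem_convexHull (hne : ∀ j ∈ l, (supp (Q j)).Nonempty)
    (hd : l.Pairwise fun i j => Disjoint (supp (Q i)) (supp (Q j))) :
    ((2 : ℂ) ^ n)⁻¹ • stabilizerOp Q s l ∈ convexHull ℝ (Set.range (productState (n := n))) := by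
  obtain ⟨R, hR⟩ := exists_common_string hd
  set w : (Fin n → Bool) → ℝ := fun σ =>
    ((2 : ℝ) ^ n)⁻¹ * (l.map fun j => 1 + sgn (s j) * eigenSign (Q j) σ).prod with hw
  have hsum : ((2 : ℂ) ^ n)⁻¹ • stabilizerOp Q s l =
      ∑ σ, w σ • productState (fun q => (R q).map fun a => (a, σ q)) := by
    conv_lhs => rw [← mul_one (stabilizerOp Q s l), ← sum_productState R, Finset.mul_sum,
      Finset.smul_sum]
    refine Finset.sum_congr rfl fun σ _ => ?_
    rw [stabilizerOp_mul_productState s R σ hR, smul_smul, ← Complex.coe_smul]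
    simp [hw]
  -- the weights sum to one because both sides have the same trace
  have hw1 : ∑ σ, w σ = 1 := by
    have := congrArg Matrix.trace hsum
    rw [Matrix.trace_smul, trace_stabilizerOp s hne hd, Matrix.trace_sum] at this
    simp only [Matrix.trace_smul, productState_trace] at this
    rw [smul_eq_mul, inv_mul_cancel₀ (pow_ne_zero _ two_ne_zero)] at this
    have h2 : ((∑ σ, w σ : ℝ) : ℂ) = 1 := by
      rw [this]; push_cast
      exact Finset.sum_congr rfl fun σ _ => by simp
    exact_mod_cast h2
  rw [hsum]
  refine (convex_convexHull ℝ _).sum_mem (fun σ _ => ?_) hw1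
    fun σ _ => subset_convexHull ℝ _ ⟨_, rfl⟩
  refine mul_nonneg (by positivity) (List.prod_nonneg fun x hx => ?_)
  obtain ⟨j, -, rfl⟩ := List.mem_map.1 hx
  have h1 : |sgn (s j) * eigenSign (Q j) σ| = 1 := by
    rw [abs_mul, abs_eigenSign]
    cases s j <;> simp [sgn]
  linarith [neg_abs_le (sgn (s j) * eigenSign (Q j) σ)]

open scoped ComplexOrder in
lemma siteState_posSemidef (s : Option (Axis × Bool)) : (siteState s).PosSemidef := by
  rcases s with _ | ⟨a, b⟩
  · exact PosSemidef.one.smul (by norm_num [Complex.nonneg_iff] : (0 : ℂ) ≤ 1 / 2)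
  · have hh : (siteState (some (a, b)))ᴴ = siteState (some (a, b)) := by
      have : a.matᴴ = a.mat := optMat_conjTranspose (some a)
      simp [siteState, conjTranspose_smul, this]
    have h2 : a.mat * a.mat = 1 := optMat_mul_self (some a)
    have hs : (siteState (some (a, b)))ᴴ * siteState (some (a, b)) = siteState (some (a, b)) := by
      rw [hh]
      simp only [siteState, smul_mul_smul_comm, add_mul, mul_add, one_mul, mul_one, h2,
        sgn_mul_self, one_smul]
      module
    rw [← hs]
    exact posSemidef_conjTranspose_mul_self _

open scoped ComplexOrder in
lemma isState_of_mem_convexHull {ρ : Operator n}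
    (h : ρ ∈ convexHull ℝ (Set.range (productState (n := n)))) : IsState ρ := by
  refine convexHull_min (t := {ρ | IsState ρ}) ?_ ?_ h
  · rintro _ ⟨s, rfl⟩
    exact ⟨siteTensor_posSemidef _ fun q => siteState_posSemidef _, productState_trace s⟩
  · intro x hx y hy a b ha hb hab
    refine ⟨(hx.1.smul ha).add (hy.1.smul hb), ?_⟩
    rw [Matrix.trace_add, Matrix.trace_smul, Matrix.trace_smul, hx.2, hy.2, ← add_smul, hab,
      one_smul]

end Stabilizer

/-! ### The initial states of the algorithm -/

section Probe

open Matrix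

variable {n r : ℕ} (P : Fin r → PauliString n) (probe : Fin r → Fin n × Axis)

/-- The single-qubit Pauli `P_j'`. -/
def probeString (j : Fin r) : PauliString n := singlePauli (probe j).1 (probe j).2

/-- The Pauli string of `i [P_j, P_j'] / 2`, without its sign. -/
def commString (j : Fin r) : PauliString n := strMul (P j) (probeString probe j)

/-- The single-qubit Pauli `p` does not commute with the string `W`, in terms of the axes at the
site of `p`: the string acts there, and with another axis. -/
def IsProbe (W : PauliString n) (p : Fin n × Axis) : Prop := W p.1 ≠ none ∧ W p.1 ≠ some p.2

lemma card_antiSites_comm (P Q : PauliString n) :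
    (antiSites P Q).card = (antiSites Q P).card := by
  congr 1
  ext q
  simp only [antiSites, Finset.mem_filter]
  tauto

lemma odd_antiSites_single {W : PauliString n} {p : Fin n × Axis} :
    Odd (antiSites W (singlePauli p.1 p.2)).card ↔ IsProbe W p := by
  rw [card_antiSites_comm, antiSites_single]
  unfold IsProbe
  split_ifs with h <;> simp [h]

lemma isProbe_of_not_commute {W : PauliString n} {p : Fin n × Axis}
    (h : pauliOp (singlePauli p.1 p.2) * pauliOp W ≠ pauliOp W * pauliOp (singlePauli p.1 p.2)) :
    IsProbe W p := by
  rw [← odd_antiSites_single]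
  by_contra h'
  exact h (pauliOp_commute (Nat.not_odd_iff_even.1 h')).symm

lemma optMul_none_right (a : Option Axis) : optMul a none = a := by
  rcases a with _ | _ | _ | _ <;> rfl

lemma optMul_right_injective (c : Option Axis) : Function.Injective fun a => optMul a c := by
  intro a b h
  rcases a with _ | _ | _ | _ <;> rcases b with _ | _ | _ | _ <;> rcases c with _ | _ | _ | _ <;>
    simp_all [optMul]

lemma strMul_single_ne {W : PauliString n} {p : Fin n × Axis} {q : Fin n} (h : q ≠ p.1) :
    strMul W (singlePauli p.1 p.2) q = W q := by
  simp [strMul, singlePauli, h, optMul_none_right]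

lemma strMul_single_self (W : PauliString n) (p : Fin n × Axis) :
    strMul W (singlePauli p.1 p.2) p.1 = optMul (W p.1) (some p.2) := by
  simp [strMul, singlePauli]

lemma IsProbe.strMul_ne_none {W : PauliString n} {p : Fin n × Axis} (h : IsProbe W p) :
    strMul W (singlePauli p.1 p.2) p.1 ≠ none := by
  rw [strMul_single_self]
  obtain ⟨h1, h2⟩ := h
  generalize W p.1 = a at *
  generalize p.2 = b at *
  rcases a with _ | _ | _ | _ <;> rcases b with _ | _ | _ <;> simp_all [optMul]

lemma IsProbe.supp_strMul {W : PauliString n} {p : Fin n × Axis} (h : IsProbe W p) :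
    supp (strMul W (singlePauli p.1 p.2)) = supp W := by
  ext q
  rw [mem_supp, mem_supp]
  by_cases hq : q = p.1
  · subst hq
    exact iff_of_true h.strMul_ne_none h.1
  · rw [strMul_single_ne hq]

/-- As an operator, `i [P_j, P_j'] / 2` is a Pauli string up to a sign. -/
lemma IsProbe.exists_sign {W : PauliString n} {p : Fin n × Axis} (h : IsProbe W p) :
    ∃ b : Bool, Complex.I * strPhase W (singlePauli p.1 p.2) = ((sgn b : ℝ) : ℂ) := by
  have e : strPhase W (singlePauli p.1 p.2) = optPhase (W p.1) (some p.2) := by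
    rw [strPhase, Finset.prod_eq_single p.1]
    · simp [singlePauli]
    · intro q _ hq
      simp only [singlePauli, if_neg hq]
      generalize W q = a
      rcases a with _ | _ | _ | _ <;> rfl
    · simp
  rw [e]
  obtain ⟨h1, h2⟩ := h
  generalize W p.1 = a at *
  generalize p.2 = b at *
  rcases a with _ | _ | _ | _ <;> rcases b with _ | _ | _ <;>
    first
    | exact absurd rfl h1
    | exact absurd rfl h2
    | (refine ⟨true, ?_⟩; simp [optPhase, sgn]; done)
    | (refine ⟨false, ?_⟩; simp [optPhase, sgn])

lemma IsProbe.commutator_eq {W : PauliString n} {p : Fin n × Axis} (h : IsProbe W p) {b : Bool}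
    (hb : Complex.I * strPhase W (singlePauli p.1 p.2) = ((sgn b : ℝ) : ℂ)) :
    (Complex.I / 2) • (pauliOp W * pauliOp (singlePauli p.1 p.2) -
      pauliOp (singlePauli p.1 p.2) * pauliOp W) =
      ((sgn b : ℝ) : ℂ) • pauliOp (strMul W (singlePauli p.1 p.2)) := by
  have hanti := pauliOp_anticommute (odd_antiSites_single.2 h)
  rw [show pauliOp (singlePauli p.1 p.2) * pauliOp W =
    -(pauliOp W * pauliOp (singlePauli p.1 p.2)) by rw [hanti, neg_neg], sub_neg_eq_add,
    ← two_smul ℂ, smul_smul, pauliOp_mul, smul_smul, ← hb]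
  congr 1
  ring

variable {P probe} {m : ℕ} {col : Fin r → Fin (m + 1)}

lemma mem_colorClass {c : Fin (m + 1)} {j : Fin r} : j ∈ colorClass col c ↔ col j = c := by
  simp [colorClass]

/-- No term meets the supports of two distinct terms of the same color. -/
lemma disjoint_of_proper (hcol : ∀ i j, (squaredGraph P).Adj i j → col i ≠ col j) {i j k : Fin r}
    (hij : i ≠ j) (hc : col i = col j) (hik : (supp (P i) ∩ supp (P k)).Nonempty) :
    Disjoint (supp (P k)) (supp (P j)) := by
  rw [Finset.disjoint_iff_inter_eq_empty, ← Finset.not_nonempty_iff_eq_empty]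
  exact fun h => hcol i j ⟨hij, k, hik, h⟩ hc

section

variable (hprobe : ∀ j, IsProbe (P j) (probe j))
include hprobe

lemma supp_commString (j : Fin r) : supp (commString P probe j) = supp (P j) :=
  (hprobe j).supp_strMul

lemma exists_signs : ∃ s : Fin r → Bool,
    ∀ j, Complex.I * strPhase (P j) (probeString probe j) = ((sgn (s j) : ℝ) : ℂ) :=
  Classical.skolem.1 fun j => (hprobe j).exists_sign

lemma initialState_eq {s : Fin r → Bool}
    (hs : ∀ j, Complex.I * strPhase (P j) (probeString probe j) = ((sgn (s j) : ℝ) : ℂ))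
    (c : Fin (m + 1)) :
    initialState P probe col c =
      ((2 : ℂ) ^ n)⁻¹ • stabilizerOp (commString P probe) s (colorClass col c) := by
  unfold initialState stabilizerOp
  congr 3
  funext j
  rw [(hprobe j).commutator_eq (hs j)]
  rfl

lemma probe_inter (j : Fin r) : (supp (P j) ∩ supp (P j)).Nonempty :=
  ⟨(probe j).1, by simpa using mem_supp.2 (hprobe j).1⟩

lemma commString_nonempty (j : Fin r) : (supp (commString P probe j)).Nonempty := by
  rw [supp_commString hprobe]
  exact ⟨_, mem_supp.2 (hprobe j).1⟩

variable (hcol : ∀ i j, (squaredGraph P).Adj i j → col i ≠ col j)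
include hcol

lemma pairwise_disjoint_commString (c : Fin (m + 1)) :
    (colorClass col c).Pairwise fun i j =>
      Disjoint (supp (commString P probe i)) (supp (commString P probe j)) := by
  have hn : (colorClass col c).Nodup := (List.nodup_finRange r).filter _
  refine hn.imp_of_mem fun {i j} hi hj hij => ?_
  rw [supp_commString hprobe, supp_commString hprobe]
  exact disjoint_of_proper hcol hij ((mem_colorClass.1 hi).trans (mem_colorClass.1 hj).symm)
    (probe_inter hprobe i)

lemma initialState_mem_convexHull (c : Fin (m + 1)) :
    initialState P probe col c ∈ convexHull ℝ (Set.range (productState (n := n))) := by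
  obtain ⟨s, hs⟩ := exists_signs hprobe
  rw [initialState_eq hprobe hs]
  exact stabilizerOp_mem_convexHull s (fun j _ => commString_nonempty hprobe j)
    (pairwise_disjoint_commString hprobe hcol c)

/-- A term `P_k` other than `P_j` does not contribute to the derivative of the expectation of
`P_j'`. As `P_k` meets `P_j`, it meets no other term of the color of `P_j`, and so there is a Pauli
string that anticommutes with the product of `P_k` and `P_j'` but leaves the initial state
invariant. -/
lemma trace_strMul_initialState_eq_zero (hinj : Function.Injective P) {j k : Fin r} (hkj : k ≠ j)
    (hk : IsProbe (P k) (probe j)) :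
    (pauliOp (strMul (P k) (probeString probe j)) *
      initialState P probe col (col j)).trace = 0 := by
  obtain ⟨s, hs⟩ := exists_signs hprobe
  rw [initialState_eq hprobe hs, mul_smul_comm, Matrix.trace_smul]
  set W := strMul (P k) (probeString probe j) with hWdef
  have hWs : supp W = supp (P k) := hk.supp_strMul
  set Q := commString P probe with hQ
  have hQs : ∀ i, supp (Q i) = supp (P i) := supp_commString hprobe
  have hjk : (supp (P j) ∩ supp (P k)).Nonempty :=
    ⟨(probe j).1, Finset.mem_inter.2 ⟨mem_supp.2 (hprobe j).1, mem_supp.2 hk.1⟩⟩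
  -- the other terms of this color avoid both `P_k` and `P_j`
  have hdk : ∀ i, i ∈ colorClass col (col j) → i ≠ j → ∀ q, W q ≠ none → Q i q = none := by
    intro i hi hij q hq
    by_contra h
    exact Finset.disjoint_left.1
      (disjoint_of_proper hcol hij.symm (mem_colorClass.1 hi).symm hjk)
      (hWs ▸ mem_supp.2 hq) (hQs i ▸ mem_supp.2 h)
  have hdj : ∀ i, i ∈ colorClass col (col j) → i ≠ j → ∀ q, Q j q ≠ none → Q i q = none := by
    intro i hi hij q hq
    by_contra h
    exact Finset.disjoint_left.1
      (disjoint_of_proper hcol hij.symm (mem_colorClass.1 hi).symm (probe_inter hprobe j))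
      (hQs j ▸ mem_supp.2 hq) (hQs i ▸ mem_supp.2 h)
  suffices ∃ U : PauliString n, Odd (antiSites U W).card ∧
      ∀ i ∈ colorClass col (col j), Even (antiSites U (Q i)).card by
    obtain ⟨U, h1, h2⟩ := this
    rw [trace_pauliOp_mul_stabilizerOp_eq_zero Q s U W _ h1 h2, smul_zero]
  by_cases h1 : ∃ q, W q ≠ none ∧ W q ≠ Q j q
  · -- the two strings differ at a site where `W` acts
    obtain ⟨q, hq1, hq2⟩ := h1
    obtain ⟨b, hb1, hb2⟩ : ∃ b, W q ≠ some b ∧ (Q j q = none ∨ Q j q = some b) := by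
      rcases hj : Q j q with _ | b
      · obtain ⟨b, hb⟩ := exists_axis_ne (W q)
        exact ⟨b, hb, Or.inl rfl⟩
      · exact ⟨b, hj ▸ hq2, Or.inr rfl⟩
    refine ⟨singlePauli q b, ?_, fun i hi => ?_⟩
    · rw [antiSites_single, if_pos ⟨hq1, hb1⟩]; simp
    · rw [antiSites_single, if_neg]
      · simp
      · rintro ⟨h3, h4⟩
        by_cases hij : i = j
        · subst hij
          rcases hb2 with hb2 | hb2
          · exact h3 hb2
          · exact h4 hb2
        · exact h3 (hdk i hi hij q hq1)
  · push Not at h1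
    have hW0 : W (probe j).1 ≠ none := hk.strMul_ne_none
    by_cases h2 : ∃ q, W q = none ∧ Q j q ≠ none
    · -- `W` is a proper part of `Q j`: change the sign of `Q j` twice and that of `W` once
      obtain ⟨q, hq1, hq2⟩ := h2
      have hne : q ≠ (probe j).1 := fun h => hW0 (h ▸ hq1)
      obtain ⟨a, ha⟩ := exists_axis_ne (Q j (probe j).1)
      obtain ⟨b, hb⟩ := exists_axis_ne (Q j q)
      set U : PauliString n :=
        fun x => if x = (probe j).1 then some a else if x = q then some b else none with hU
      have hWj := h1 _ hW0
      have e1 : antiSites U W = {(probe j).1} := by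
        ext x
        simp only [antiSites, Finset.mem_filter, Finset.mem_univ, true_and,
          Finset.mem_singleton, hU]
        constructor
        · rintro ⟨h3, h4, -⟩
          by_contra hx
          rw [if_neg hx] at h3
          by_cases hxq : x = q
          · exact h4 (hxq ▸ hq1)
          · simp [hxq] at h3
        · rintro rfl
          rw [if_pos rfl]
          exact ⟨by simp, hW0, by rw [hWj]; exact ha.symm⟩
      have e2 : antiSites U (Q j) = {(probe j).1, q} := by
        ext x
        simp only [antiSites, Finset.mem_filter, Finset.mem_univ, true_and,
          Finset.mem_insert, Finset.mem_singleton, hU]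
        constructor
        · rintro ⟨h3, -, -⟩
          by_contra! hx
          simp [hx.1, hx.2] at h3
        · rintro (rfl | rfl)
          · rw [if_pos rfl]
            exact ⟨by simp, hWj ▸ hW0, ha.symm⟩
          · rw [if_neg hne, if_pos rfl]
            exact ⟨by simp, hq2, hb.symm⟩
      refine ⟨U, by rw [e1]; simp, fun i hi => ?_⟩
      by_cases hij : i = j
      · subst hij
        rw [e2, Finset.card_pair hne.symm]
        exact even_two
      · have e3 : antiSites U (Q i) = ∅ := by
          refine Finset.filter_eq_empty_iff.2 fun x _ hx => ?_
          obtain ⟨h3, h4, -⟩ := hx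
          by_cases hx1 : x = (probe j).1
          · exact h4 (hx1 ▸ hdk i hi hij _ hW0)
          · by_cases hx2 : x = q
            · exact h4 (hx2 ▸ hdj i hi hij _ hq2)
            · simp [hU, hx1, hx2] at h3
        rw [e3]; simp
    · -- the remaining case is `W = Q j`, which would give `P k = P j`
      push Not at h2
      have hWQ : W = Q j := by
        funext q
        by_cases h : W q = none
        · rw [h, h2 q h]
        · exact h1 q h
      refine absurd (hinj (funext fun q => ?_)) hkj
      have hq := congrFun hWQ q
      by_cases h : q = (probe j).1
      · subst h
        have e1 : W (probe j).1 = optMul (P k (probe j).1) (some (probe j).2) :=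
          strMul_single_self _ _
        have e2 : Q j (probe j).1 = optMul (P j (probe j).1) (some (probe j).2) :=
          strMul_single_self _ _
        exact optMul_right_injective _ (e1.symm.trans (hq.trans e2))
      · have e1 : W q = P k q := strMul_single_ne h
        have e2 : Q j q = P j q := strMul_single_ne h
        exact e1.symm.trans (hq.trans e2)

/-- The derivative at time zero of the expectation of `P_j'` is `2 θ_j`. -/
lemma trace_heisenberg_probe (hinj : Function.Injective P) (θ : Fin r → ℝ) (j : Fin r) :
    (heisenberg (hamiltonian P θ) (pauliOp (probeString probe j)) *
      initialState P probe col (col j)).trace = ((2 * θ j : ℝ) : ℂ) := by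
  obtain ⟨s, hs⟩ := exists_signs hprobe
  have hρ := isState_of_mem_convexHull (initialState_mem_convexHull hprobe hcol (col j))
  rw [heisenberg_pauliOp, Finset.sum_mul, Matrix.trace_sum, Finset.sum_eq_single j]
  · have h1 : (((sgn (s j) : ℝ) : ℂ) • pauliOp (commString P probe j)) *
        initialState P probe col (col j) = initialState P probe col (col j) := by
      rw [initialState_eq hprobe hs, mul_smul_comm, smul_pauliOp_mul_stabilizerOp s
        (pairwise_disjoint_commString hprobe hcol _) (mem_colorClass.2 rfl)]
    have h2 : (2 * Complex.I * (θ j : ℂ) * strPhase (P j) (probeString probe j)) •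
        pauliOp (strMul (P j) (probeString probe j)) =
        ((2 * θ j : ℝ) : ℂ) • (((sgn (s j) : ℝ) : ℂ) • pauliOp (commString P probe j)) := by
      rw [← hs, smul_smul]
      congr 1
      push_cast
      ring
    rw [h2, smul_mul_assoc, h1, Matrix.trace_smul, hρ.2, smul_eq_mul, mul_one]
  · intro k hk hkj
    rw [smul_mul_assoc, Matrix.trace_smul, trace_strMul_initialState_eq_zero hprobe hcol hinj hkj
      (odd_antiSites_single.1 (Finset.mem_filter.1 hk).2), smul_zero]
  · intro h
    refine absurd ?_ h
    exact Finset.mem_filter.2 ⟨Finset.mem_univ j, odd_antiSites_single.2 (hprobe j)⟩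

/-- The supports of the terms of one color are disjoint, so their probes sit on distinct qubits and
are all measured at once. -/
lemma probeSetting_probe (j : Fin r) :
    probeSetting probe col (col j) (probe j).1 = some (probe j).2 := by
  have hfind : ((colorClass col (col j)).find? fun i => (probe i).1 = (probe j).1) = some j := by
    have hmem : ∃ i ∈ colorClass col (col j), decide ((probe i).1 = (probe j).1) = true :=
      ⟨j, mem_colorClass.2 rfl, by simp⟩
    obtain ⟨i, hi⟩ := Option.isSome_iff_exists.1 (List.find?_isSome.2 hmem)
    have hi1 : (probe i).1 = (probe j).1 := by simpa using List.find?_some hi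
    have hi2 := mem_colorClass.1 (List.mem_of_find?_eq_some hi)
    rw [hi]
    by_contra hij
    have hij : i ≠ j := fun h => hij (congrArg some h)
    exact Finset.disjoint_left.1
      (disjoint_of_proper hcol hij hi2 (probe_inter hprobe i))
      (mem_supp.2 (hprobe i).1) (mem_supp.2 (hi1 ▸ (hprobe j).1))
  simp [probeSetting, hfind]

end

end Probe

/-! ### The law of a query -/

section Law

open Matrix MeasureTheory ProbabilityTheory

variable {n : ℕ}

/-- The projector on outcome `b` at a site with the given measurement setting. -/
noncomputable def siteEffect (c : Option Axis) (b : Bool) : Matrix (Fin 2) (Fin 2) ℂ :=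
  match c with
  | none => if b then 1 else 0
  | some a => (1 / 2 : ℂ) • (1 + ((sgn b : ℝ) : ℂ) • a.mat)

lemma effect_eq (setting : Fin n → Option Axis) (s : Fin n → Bool) :
    effect setting s = siteTensor fun q => siteEffect (setting q) (s q) := rfl

lemma siteEffect_conjTranspose (c : Option Axis) (b : Bool) :
    (siteEffect c b)ᴴ = siteEffect c b := by
  rcases c with _ | a
  · cases b <;> simp [siteEffect]
  · have : a.matᴴ = a.mat := optMat_conjTranspose (some a)
    simp [siteEffect, conjTranspose_smul, this]

lemma siteEffect_mul_self (c : Option Axis) (b : Bool) :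
    siteEffect c b * siteEffect c b = siteEffect c b := by
  rcases c with _ | a
  · cases b <;> simp [siteEffect]
  · have h2 : a.mat * a.mat = 1 := optMat_mul_self (some a)
    simp only [siteEffect, smul_mul_smul_comm, add_mul, mul_add, one_mul, mul_one, h2,
      sgn_mul_self, one_smul]
    module

lemma sum_siteEffect (c : Option Axis) : ∑ b, siteEffect c b = 1 := by
  rcases c with _ | a
  · simp [siteEffect]
  · simp only [siteEffect, Fintype.sum_bool, sgn, if_true, Bool.false_eq_true,
      if_false, Complex.ofReal_one, Complex.ofReal_neg]
    module

lemma sum_sgn_siteEffect (a : Axis) :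
    ∑ b, ((sgn b : ℝ) : ℂ) • siteEffect (some a) b = a.mat := by
  simp only [siteEffect, Fintype.sum_bool, sgn, if_true, Bool.false_eq_true,
    if_false, Complex.ofReal_one, Complex.ofReal_neg]
  module

lemma effect_conjTranspose_mul_self (setting : Fin n → Option Axis) (s : Fin n → Bool) :
    (effect setting s)ᴴ * effect setting s = effect setting s := by
  simp only [effect_eq, siteTensor_conjTranspose, siteEffect_conjTranspose, siteTensor_mul,
    siteEffect_mul_self]

lemma sum_effect (setting : Fin n → Option Axis) : ∑ s, effect setting s = 1 := by
  simp only [effect_eq]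
  rw [sum_siteTensor fun q b => siteEffect (setting q) b]
  simp only [sum_siteEffect, siteTensor_one]

/-- The outcome on a measured qubit, weighted with its value, is the spectral decomposition of the
Pauli matrix there. -/
lemma sum_sgn_effect (setting : Fin n → Option Axis) {q : Fin n} {a : Axis}
    (h : setting q = some a) :
    ∑ s : Fin n → Bool, ((sgn (s q) : ℝ) : ℂ) • effect setting s =
      pauliOp (singlePauli q a) := by
  have e : ∀ s : Fin n → Bool, ((sgn (s q) : ℝ) : ℂ) • effect setting s =
      siteTensor fun q' => (if q' = q then ((sgn (s q') : ℝ) : ℂ) else 1) •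
        siteEffect (setting q') (s q') := by
    intro s
    rw [siteTensor_smul, effect_eq, Finset.prod_ite_eq' Finset.univ q]
    simp
  simp only [e]
  rw [sum_siteTensor fun q' b => (if q' = q then ((sgn b : ℝ) : ℂ) else 1) •
        siteEffect (setting q') b, pauliOp_eq]
  congr 1
  funext q'
  by_cases hq : q' = q
  · subst hq
    simp only [if_true, h, sum_sgn_siteEffect, singlePauli, optMat]
  · simp only [if_neg hq, one_smul, sum_siteEffect, singlePauli, optMat]

/-- The probability of the outcome `s`. -/
noncomputable def bornProb (H : Operator n) (Q : Query n) (s : Fin n → Bool) : ℝ :=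
  (Matrix.trace (effect Q.setting s * evolve H Q.time Q.init)).re

variable {H : Operator n} {Q : Query n}

lemma bornProb_nonneg (hH : Hᴴ = H) (hQ : IsState Q.init) (s : Fin n → Bool) :
    0 ≤ bornProb H Q s :=
  (Complex.nonneg_iff.1 (trace_mul_nonneg (hQ.evolve hH Q.time).1
    (effect_conjTranspose_mul_self Q.setting s))).1

lemma sum_bornProb (hH : Hᴴ = H) (hQ : IsState Q.init) : ∑ s, bornProb H Q s = 1 := by
  simp only [bornProb]
  rw [← Complex.re_sum, ← Matrix.trace_sum, ← Finset.sum_mul, sum_effect, one_mul,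
    (hQ.evolve hH Q.time).2, Complex.one_re]

lemma law_eq (H : Operator n) (Q : Query n) :
    Q.law H = ∑ s, ENNReal.ofReal (bornProb H Q s) • Measure.dirac s := rfl

lemma isProbabilityMeasure_law (hH : Hᴴ = H) (hQ : IsState Q.init) :
    IsProbabilityMeasure (Q.law H) := by
  constructor
  simp only [law_eq, Measure.coe_finsetSum, Finset.sum_apply, Measure.smul_apply,
    measure_univ, smul_eq_mul, mul_one]
  rw [← ENNReal.ofReal_sum_of_nonneg fun s _ => bornProb_nonneg hH hQ s]
  exact (congrArg ENNReal.ofReal (sum_bornProb hH hQ)).trans ENNReal.ofReal_one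

/-- The mean of the outcome on a measured qubit is the expectation of the Pauli matrix there. -/
lemma integral_sgn_law (hH : Hᴴ = H) (hQ : IsState Q.init) {q : Fin n} {a : Axis}
    (h : Q.setting q = some a) :
    ∫ s, sgn (s q) ∂(Q.law H) =
      (pauliOp (singlePauli q a) * evolve H Q.time Q.init).trace.re := by
  rw [law_eq, integral_finsetSum_measure fun s _ =>
    (Integrable.smul_measure (integrable_dirac (by simp)) ENNReal.ofReal_ne_top)]
  rw [← sum_sgn_effect Q.setting h, Finset.sum_mul, Matrix.trace_sum, Complex.re_sum]
  refine Finset.sum_congr rfl fun s _ => ?_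
  rw [integral_smul_measure, integral_dirac, smul_mul_assoc, Matrix.trace_smul,
    ENNReal.toReal_ofReal (bornProb_nonneg hH hQ s), smul_eq_mul, smul_eq_mul,
    Complex.re_ofReal_mul, mul_comm, bornProb]

end Law

/-! ### Concentration -/

section Concentration

open MeasureTheory ProbabilityTheory

variable {ι : Type*} [Fintype ι] {Ω : Type*} [MeasurableSpace Ω] [DiscreteMeasurableSpace Ω]
  (μ : ι → Measure Ω) [∀ i, IsProbabilityMeasure (μ i)]

lemma abs_sgn (b : Bool) : |sgn b| = 1 := by
  cases b <;> simp [sgn]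

/-- Chebyshev's inequality for a linear combination of independent variables with values in
`[-1, 1]`. -/
lemma pi_measure_deviation_le (g : Ω → ℝ) (hg : ∀ x, |g x| ≤ 1) (a : ι → ℝ) {η : ℝ} (hη : 0 < η) :
    Measure.pi μ {ω | η ≤ |∑ i, a i * g (ω i) - ∑ i, a i * ∫ x, g x ∂(μ i)|} ≤
      ENNReal.ofReal ((∑ i, a i ^ 2) / η ^ 2) := by
  have hbdd : ∀ i, ∀ x, |a i * g x| ≤ |a i| := fun i x => by
    rw [abs_mul]
    exact mul_le_of_le_one_right (abs_nonneg _) (hg x)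
  have hmem : ∀ i, MemLp (fun x => a i * g x) 2 (μ i) := fun i =>
    MemLp.of_bound (Measurable.of_discrete.aestronglyMeasurable) |a i|
      (Filter.Eventually.of_forall fun x => hbdd i x)
  have hmem' : ∀ i, MemLp (fun ω : ι → Ω => a i * g (ω i)) 2 (Measure.pi μ) := fun i =>
    (hmem i).comp_measurePreserving (measurePreserving_eval μ i)
  have hvar : Var[∑ i, fun ω : ι → Ω => a i * g (ω i); Measure.pi μ] ≤ ∑ i, a i ^ 2 := by
    rw [variance_sum_pi hmem]
    refine Finset.sum_le_sum fun i _ => (variance_le_sq_of_bounded (a := -|a i|) (b := |a i|)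
      (Filter.Eventually.of_forall fun x => abs_le.1 (hbdd i x)) (hmem i).1.aemeasurable).trans ?_
    rw [sub_neg_eq_add, add_self_div_two, sq_abs]
  have hmean : (Measure.pi μ)[∑ i, fun ω : ι → Ω => a i * g (ω i)] =
      ∑ i, a i * ∫ x, g x ∂(μ i) := by
    simp only [Finset.sum_apply]
    rw [integral_finsetSum _ fun i _ => (hmem' i).integrable (by norm_num)]
    refine Finset.sum_congr rfl fun i _ => ?_
    rw [integral_const_mul]
    congr 1
    exact integral_comp_eval (μ := μ) (Measurable.of_discrete.aestronglyMeasurable)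
  have h := meas_ge_le_variance_div_sq (memLp_finsetSum' Finset.univ fun i _ => hmem' i) hη
  rw [hmean] at h
  simp only [Finset.sum_apply] at h
  refine h.trans (ENNReal.ofReal_le_ofReal ?_)
  gcongr

/-- Events that depend on disjoint blocks of coordinates are independent. -/
lemma pi_measure_biInter_of_disjoint [Finite Ω] [DecidableEq ι] {κ : Type*} [DecidableEq κ]
    (S : κ → Finset ι) (B : κ → Set (ι → Ω))
    (hS : ∀ k k', k ≠ k' → Disjoint (S k) (S k'))
    (hB : ∀ k ω ω', (∀ i ∈ S k, ω i = ω' i) → ω ∈ B k → ω' ∈ B k) (T : Finset κ) :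
    Measure.pi μ (⋂ k ∈ T, B k) = ∏ k ∈ T, Measure.pi μ (B k) := by
  have hind : iIndepFun (fun i (ω : ι → Ω) => ω i) (Measure.pi μ) :=
    iIndepFun_pi (X := fun _ => id) fun _ => aemeasurable_id
  have hpre : ∀ (U : Finset ι) (E : Set (ι → Ω)),
      (∀ ω ω', (∀ i ∈ U, ω i = ω' i) → ω ∈ E → ω' ∈ E) →
      E = (fun ω (i : U) => ω i) ⁻¹' ((fun (ω : ι → Ω) (i : U) => ω i) '' E) := by
    intro U E hE
    refine Set.Subset.antisymm (Set.subset_preimage_image _ _) ?_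
    rintro ω ⟨ω', h1, h2⟩
    exact hE ω' ω (fun i hi => congrFun h2 ⟨i, hi⟩) h1
  induction T using Finset.induction_on with
  | empty => simp
  | insert k T hk ih =>
    rw [Finset.set_biInter_insert, Finset.prod_insert hk, ← ih]
    have hd : Disjoint (S k) (T.biUnion S) := by
      rw [Finset.disjoint_biUnion_right]
      exact fun k' hk' => hS k k' (by rintro rfl; exact hk hk')
    have hi := hind.indepFun_finset (S k) (T.biUnion S) hd fun i => measurable_pi_apply i
    have e1 := hpre (S k) (B k) (hB k)
    have e2 := hpre (T.biUnion S) (⋂ k ∈ T, B k) fun ω ω' h hω => by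
      simp only [Set.mem_iInter] at hω ⊢
      exact fun k' hk' => hB k' ω ω' (fun i hi' => h i (Finset.mem_biUnion.2 ⟨k', hk', hi'⟩))
        (hω k' hk')
    rw [e1, e2]
    exact hi.measure_inter_preimage_eq_mul _ _ (Set.toFinite _).measurableSet
      (Set.toFinite _).measurableSet

open scoped Classical in
/-- If each of `K` independent events has probability at most `1 / 64`, then at least half of them
happen with probability at most `4⁻ᴷ`: there are at most `2ᴷ` sets of at least `K / 2` events. -/
lemma measure_half_le {Ω' : Type*} [MeasurableSpace Ω'] (ν : Measure Ω') {K : ℕ}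
    (B : Fin K → Set Ω') (hB : ∀ k, ν (B k) ≤ ENNReal.ofReal (1 / 8) ^ 2)
    (hind : ∀ T : Finset (Fin K), ν (⋂ k ∈ T, B k) = ∏ k ∈ T, ν (B k)) :
    ν {ω | K ≤ 2 * (Finset.univ.filter fun k => ω ∈ B k).card} ≤ ENNReal.ofReal ((1 / 4) ^ K) := by
  have hsub : {ω | K ≤ 2 * (Finset.univ.filter fun k => ω ∈ B k).card} ⊆
      ⋃ T ∈ Finset.univ.filter fun T : Finset (Fin K) => K ≤ 2 * T.card, ⋂ k ∈ T, B k := by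
    intro ω hω
    simp only [Set.mem_iUnion, Set.mem_iInter]
    exact ⟨_, Finset.mem_filter.2 ⟨Finset.mem_univ _, hω⟩, fun k hk => (Finset.mem_filter.1 hk).2⟩
  have h1 : ENNReal.ofReal (1 / 8) ≤ 1 := ENNReal.ofReal_le_one.2 (by norm_num)
  refine (measure_mono hsub).trans ((measure_biUnion_finset_le _ _).trans ?_)
  have hT : ∀ T ∈ Finset.univ.filter (fun T : Finset (Fin K) => K ≤ 2 * T.card),
      ν (⋂ k ∈ T, B k) ≤ ENNReal.ofReal (1 / 8) ^ K := by
    intro T hT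
    rw [hind]
    refine (Finset.prod_le_pow_card _ _ _ fun k _ => hB k).trans ?_
    rw [← pow_mul]
    exact pow_le_pow_right_of_le_one' h1 (Finset.mem_filter.1 hT).2
  refine (Finset.sum_le_card_nsmul _ _ _ hT).trans ?_
  have hcard : (Finset.univ.filter (fun T : Finset (Fin K) => K ≤ 2 * T.card)).card ≤ 2 ^ K :=
    (Finset.card_filter_le _ _).trans (by simp)
  rw [nsmul_eq_mul]
  have e : ((2 ^ K : ℕ) : ENNReal) * ENNReal.ofReal (1 / 8) ^ K =
      ENNReal.ofReal ((1 / 4) ^ K) := by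
    have h2 : ((2 ^ K : ℕ) : ENNReal) = ENNReal.ofReal (2 ^ K) := by
      rw [← ENNReal.ofReal_natCast]; norm_num
    rw [h2, ← ENNReal.ofReal_pow (by norm_num), ← ENNReal.ofReal_mul (by positivity), ← mul_pow]
    norm_num
  rw [← e]
  gcongr

end Concentration

/-! ### The estimator -/

section Estimator

open Matrix MeasureTheory ProbabilityTheory

variable {n r m N L K : ℕ}

/-- The estimate of one coefficient from the repetition `k`. -/
noncomputable def estimate (A : ℝ) (q : Fin n) (c : Fin (m + 1)) (data : Record n m N L K)
    (k : Fin K) : ℝ :=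
  ∑ l, 2 / A * chebWeight L l * ((∑ i : Fin N, sgn (data (c, k, l, i) q)) / N) / 2

lemma processData_val (probe : Fin r → Fin n × Axis) (A : ℝ) (col : Fin r → Fin (m + 1))
    (data : Record n m N L K) (j : Fin r) :
    (processData probe A col data).val j =
      (medianT (List.ofFn (estimate A (probe j).1 (col j) data))).val := by
  have e : ∀ k, estimate A (probe j).1 (col j) data k =
      (derivativeT A fun l => (∑ i : Fin N, sgn (data (col j, k, l, i) (probe j).1)) / N).val / 2 :=
    fun k => by rw [derivativeT_val, estimate, Finset.sum_div]
  rw [funext e]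
  rfl

/-- The coefficient of the outcome of the run `w` in the estimate from color `c` and
repetition `k`. -/
noncomputable def runWeight (A : ℝ) (c : Fin (m + 1)) (k : Fin K) (w : Run m N L K) : ℝ :=
  if w.1 = c ∧ w.2.1 = k then 1 / A * chebWeight L w.2.2.1 / N else 0

lemma sum_run (c : Fin (m + 1)) (k : Fin K) (f : Run m N L K → ℝ) :
    ∑ w, (if w.1 = c ∧ w.2.1 = k then f w else 0) = ∑ l, ∑ i, f (c, k, l, i) := by
  rw [Fintype.sum_prod_type, Finset.sum_eq_single c, Fintype.sum_prod_type,
    Finset.sum_eq_single k, Fintype.sum_prod_type]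
  · simp
  · intro k' _ hk; simp [hk]
  · simp
  · intro c' _ hc; simp [hc]
  · simp

lemma estimate_eq_sum (A : ℝ) (q : Fin n) (c : Fin (m + 1)) (data : Record n m N L K)
    (k : Fin K) : estimate A q c data k = ∑ w, runWeight A c k w * sgn (data w q) := by
  simp only [runWeight, ite_mul, zero_mul]
  rw [sum_run c k fun w => 1 / A * chebWeight L w.2.2.1 / N * sgn (data w q), estimate]
  refine Finset.sum_congr rfl fun l _ => ?_
  change _ = ∑ i, 1 / A * chebWeight L l / N * sgn (data (c, k, l, i) q)
  rw [← Finset.mul_sum]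
  ring

lemma sum_runWeight_sq_le (A : ℝ) (c : Fin (m + 1)) (k : Fin K) :
    ∑ w : Run m N L K, runWeight A c k w ^ 2 ≤ 4 * (L : ℝ) ^ 5 / (A ^ 2 * N) := by
  simp only [runWeight, ite_pow, zero_pow two_ne_zero]
  rw [sum_run c k fun w => (1 / A * chebWeight L w.2.2.1 / N) ^ 2]
  rcases Nat.eq_zero_or_pos N with rfl | hN
  · simp
  have hN' : (0 : ℝ) < N := by exact_mod_cast hN
  have h : ∀ l : Fin L, ∑ _i : Fin N, (1 / A * chebWeight L l / N) ^ 2 ≤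
      4 * (L : ℝ) ^ 4 / (A ^ 2 * N) := by
    intro l
    have hw := sq_le_sq' (neg_le_of_abs_le (abs_chebWeight_le L l))
      (le_of_abs_le (abs_chebWeight_le L l))
    rw [Finset.sum_const, Finset.card_univ, Fintype.card_fin, nsmul_eq_mul]
    calc (N : ℝ) * (1 / A * chebWeight L l / N) ^ 2 = chebWeight L l ^ 2 / (A ^ 2 * N) := by
          field_simp
      _ ≤ (2 * (L : ℝ) ^ 2) ^ 2 / (A ^ 2 * N) := by gcongr
      _ = _ := by ring
  refine (Finset.sum_le_card_nsmul _ _ _ fun l _ => h l).trans (le_of_eq ?_)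
  rw [Finset.card_univ, Fintype.card_fin, nsmul_eq_mul]
  ring

variable (P : Fin r → PauliString n) (θ : Fin r → ℝ) (probe : Fin r → Fin n × Axis)

/-- The noiseless estimate errs only by the remainder of the Taylor polynomial, amplified by the
weights. -/
lemma bias_le {D : ℕ} (hD : (interactionGraph P).maxDegree = D)
    {col : Fin r → Fin (m + 1)} (hinj : Function.Injective P)
    (hprobe : ∀ j, IsProbe (P j) (probe j))
    (hcol : ∀ i j, (squaredGraph P).Adj i j → col i ≠ col j)
    (hL : 2 ≤ L) {A : ℝ} (hA : 0 < A) (j : Fin r) :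
    |∑ l, 1 / A * chebWeight L l * (pauliOp (singlePauli (probe j).1 (probe j).2) *
        evolve (hamiltonian P θ) (A / 2 * (1 + chebNode L l))
          (initialState P probe col (col j))).trace.re - θ j| ≤
      2 * (L : ℝ) ^ 3 / A * (2 * (D + 1) * ‖θ‖ * A) ^ L := by
  set ρ := initialState P probe col (col j)
  have hρ : IsState ρ := isState_of_mem_convexHull (initialState_mem_convexHull hprobe hcol _)
  set W := singlePauli (probe j).1 (probe j).2
  have hW : supp W ⊆ supp (P j) := by
    intro q hq
    have : q = (probe j).1 := by
      by_contra h
      exact mem_supp.1 hq (by simp [W, singlePauli, h])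
    exact this ▸ mem_supp.2 (hprobe j).1
  set g : ℕ → ℂ := fun k => ((heisenberg (hamiltonian P θ) ^ k) (pauliOp W) * ρ).trace with hg
  set F : Fin L → ℝ := fun l => (pauliOp W *
    evolve (hamiltonian P θ) (A / 2 * (1 + chebNode L l)) ρ).trace.re with hF
  have htay := sum_chebWeight_mul_taylor hL hA.ne' fun k => (g k).re / k.factorial
  have hg1 : (g 1).re = 2 * θ j := by
    simp only [hg, pow_one]
    rw [show pauliOp W = pauliOp (probeString probe j) from rfl,
      trace_heisenberg_probe hprobe hcol hinj θ j, Complex.ofReal_re]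
  simp only [Nat.factorial_one, Nat.cast_one, div_one, hg1] at htay
  set T : Fin L → ℝ := fun l => ∑ k ∈ Finset.range L,
    (g k).re / k.factorial * (A / 2 * (1 + chebNode L l)) ^ k with hT
  have hrem : ∀ l, |F l - T l| ≤ (2 * (D + 1) * ‖θ‖ * A) ^ L := by
    intro l
    have hz := abs_le.1 (abs_chebNode_le L l)
    have ht0 : 0 ≤ A / 2 * (1 + chebNode L l) := mul_nonneg (by positivity) (by linarith)
    have ht1 : A / 2 * (1 + chebNode L l) ≤ A := by nlinarith
    have h := norm_expectation_sub_taylor_le P θ hD hρ hW L ht0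
    refine le_trans (le_of_eq_of_le ?_ (Complex.abs_re_le_norm _)) (h.trans ?_)
    · rw [Complex.sub_re, Complex.re_sum]
      congr 2
      refine Finset.sum_congr rfl fun k _ => ?_
      rw [Complex.re_ofReal_mul]
      ring
    · gcongr
  have hsplit : ∑ l, 1 / A * chebWeight L l * F l - θ j =
      ∑ l, 1 / A * chebWeight L l * (F l - T l) := by
    have : θ j = ∑ l, 1 / A * chebWeight L l * T l := by
      have h2 : ∑ l, 2 / A * chebWeight L l * T l = 2 * ∑ l, 1 / A * chebWeight L l * T l := by
        rw [Finset.mul_sum]; exact Finset.sum_congr rfl fun l _ => by ring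
      have h3 := htay
      rw [h2] at h3
      linarith
    rw [this, ← Finset.sum_sub_distrib]
    exact Finset.sum_congr rfl fun l _ => by ring
  rw [hsplit]
  refine (Finset.abs_sum_le_sum_abs _ _).trans ?_
  have hterm : ∀ l ∈ Finset.univ, |1 / A * chebWeight L l * (F l - T l)| ≤
      1 / A * (2 * (L : ℝ) ^ 2) * (2 * (D + 1) * ‖θ‖ * A) ^ L := by
    intro l _
    rw [abs_mul, abs_mul, abs_of_pos (by positivity : 0 < 1 / A)]
    gcongr
    · exact abs_chebWeight_le L l
    · exact hrem l
  refine (Finset.sum_le_card_nsmul _ _ _ hterm).trans (le_of_eq ?_)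
  rw [Finset.card_univ, Fintype.card_fin, nsmul_eq_mul]
  ring

variable {P θ probe}

/-- Failure probability of the median of the `K` estimates of one coefficient, provided that the
bias of each estimate is at most `η` and its standard deviation at most `η / 8`. -/
lemma measure_median_far_le {D : ℕ} (hD : (interactionGraph P).maxDegree = D)
    {col : Fin r → Fin (m + 1)} (hinj : Function.Injective P)
    (hprobe : ∀ j, IsProbe (P j) (probe j))
    (hcol : ∀ i j, (squaredGraph P).Adj i j → col i ≠ col j)
    (hL : 2 ≤ L) (hN : 0 < N) (hK : 0 < K) {A η : ℝ} (hA : 0 < A) (hη : 0 < η)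
    (hbias : 2 * (L : ℝ) ^ 3 / A * (2 * (D + 1) * ‖θ‖ * A) ^ L ≤ η)
    (hvar : 4 * (L : ℝ) ^ 5 / (A ^ 2 * N) / η ^ 2 ≤ 1 / 64) (j : Fin r) :
    recordLaw P θ probe col N L K A
      {data | ¬ |(processData probe A col data).val j - θ j| ≤ 2 * η} ≤
        ENNReal.ofReal ((1 / 4) ^ K) := by
  classical
  have hH := hamiltonian_conjTranspose P θ
  have hst : ∀ w : Run m N L K, IsState (queries P probe col N L K A w).init := fun w =>
    isState_of_mem_convexHull (initialState_mem_convexHull hprobe hcol _)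
  have hprob : ∀ w : Run m N L K,
      IsProbabilityMeasure ((queries P probe col N L K A w).law (hamiltonian P θ)) := fun w =>
    isProbabilityMeasure_law hH (hst w)
  set q := (probe j).1 with hq
  set B : Fin K → Set (Record n m N L K) := fun k =>
    {data | 2 * η < |estimate A q (col j) data k - θ j|} with hB
  -- only the runs of color `col j` matter for the mean of an estimate
  have hmean : ∀ k, ∑ w : Run m N L K, runWeight A (col j) k w *
      ∫ s, sgn (s q) ∂((queries P probe col N L K A w).law (hamiltonian P θ)) =
      ∑ l, 1 / A * chebWeight L l * (pauliOp (singlePauli (probe j).1 (probe j).2) *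
        evolve (hamiltonian P θ) (A / 2 * (1 + chebNode L l))
          (initialState P probe col (col j))).trace.re := by
    intro k
    simp only [runWeight, ite_mul, zero_mul]
    rw [sum_run (col j) k fun w => 1 / A * chebWeight L w.2.2.1 / N *
      ∫ s, sgn (s q) ∂((queries P probe col N L K A w).law (hamiltonian P θ))]
    refine Finset.sum_congr rfl fun l _ => ?_
    have hint : ∀ i : Fin N, ∫ s, sgn (s q)
        ∂((queries P probe col N L K A (col j, k, l, i)).law (hamiltonian P θ)) =
        (pauliOp (singlePauli (probe j).1 (probe j).2) *
          evolve (hamiltonian P θ) (A / 2 * (1 + chebNode L l))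
            (initialState P probe col (col j))).trace.re := fun i =>
      integral_sgn_law hH (hst _) (probeSetting_probe hprobe hcol j)
    simp only [hint]
    rw [Finset.sum_const, Finset.card_univ, Fintype.card_fin, nsmul_eq_mul]
    have : (N : ℝ) ≠ 0 := by exact_mod_cast hN.ne'
    field_simp
  have hBk : ∀ k, recordLaw P θ probe col N L K A (B k) ≤ ENNReal.ofReal (1 / 8) ^ 2 := by
    intro k
    have hdev := pi_measure_deviation_le
      (fun w : Run m N L K => (queries P probe col N L K A w).law (hamiltonian P θ))
      (fun s : Fin n → Bool => sgn (s q)) (fun s => (abs_sgn _).le) (runWeight A (col j) k) hη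
    rw [hmean] at hdev
    refine (measure_mono fun data hdata => ?_).trans (hdev.trans ?_)
    · have hb := (bias_le P θ probe hD hinj hprobe hcol hL hA j).trans hbias
      have h2 : 2 * η < |estimate A q (col j) data k - θ j| := hdata
      rw [estimate_eq_sum] at h2
      have := (abs_sub_le (∑ w, runWeight A (col j) k w * sgn (data w q)) _ (θ j)).trans
        (add_le_add_right hb _)
      change η ≤ _
      linarith
    · rw [← ENNReal.ofReal_pow (by norm_num)]
      refine ENNReal.ofReal_le_ofReal ((div_le_div_of_nonneg_right
        (sum_runWeight_sq_le A (col j) k) (sq_nonneg η)).trans (hvar.trans ?_))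
      norm_num
  have hind : ∀ T : Finset (Fin K), recordLaw P θ probe col N L K A (⋂ k ∈ T, B k) =
      ∏ k ∈ T, recordLaw P θ probe col N L K A (B k) := by
    intro T
    refine pi_measure_biInter_of_disjoint _
      (fun k => Finset.univ.filter fun w : Run m N L K => w.2.1 = k) B ?_ ?_ T
    · intro k k' hkk'
      rw [Finset.disjoint_filter]
      rintro w - rfl h
      exact hkk' h
    · intro k ω ω' h hω
      have : estimate A q (col j) ω k = estimate A q (col j) ω' k := by
        unfold estimate
        refine Finset.sum_congr rfl fun l _ => ?_
        congr 3
        refine Finset.sum_congr rfl fun i _ => ?_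
        rw [h (col j, k, l, i) (Finset.mem_filter.2 ⟨Finset.mem_univ _, rfl⟩)]
      change 2 * η < _ at hω
      change 2 * η < _
      rwa [← this]
  refine (measure_mono fun data hdata => ?_).trans (measure_half_le _ B hBk hind)
  by_contra hfew
  refine hdata ?_
  have hfew : 2 * (Finset.univ.filter fun k => data ∈ B k).card < K := not_le.1 hfew
  have hne : List.ofFn (estimate A q (col j) data) ≠ [] := by
    rw [ne_eq, List.ofFn_eq_nil_iff]; omega
  have hcount : (List.ofFn (estimate A q (col j) data)).countP
      (fun x => ¬ (θ j - 2 * η ≤ x ∧ x ≤ θ j + 2 * η)) =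
      (Finset.univ.filter fun k => data ∈ B k).card := by
    rw [List.ofFn_eq_map, List.countP_map, List.countP_eq_length_filter,
      ← List.toFinset_card_of_nodup ((List.nodup_finRange K).filter _)]
    congr 1
    ext k
    rw [List.mem_toFinset, List.mem_filter, Finset.mem_filter]
    refine and_congr (by simp) ?_
    change decide (¬ _) = true ↔ 2 * η < _
    rw [decide_eq_true_eq, ← not_le, not_iff_not, abs_le]
    constructor <;> rintro ⟨h1, h2⟩ <;> constructor <;> linarith
  obtain ⟨h1, h2⟩ := (medianT_spec _ hne).2 (θ j - 2 * η) (θ j + 2 * η) (by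
    rw [hcount, List.length_ofFn]; exact hfew)
  change |_ - θ j| ≤ 2 * η
  rw [processData_val, abs_le]
  constructor <;> linarith

/-- Union bound over the coefficients. -/
lemma le_recordLaw_forall_abs_sub_le {D : ℕ} (hD : (interactionGraph P).maxDegree = D)
    {col : Fin r → Fin (m + 1)} (hinj : Function.Injective P)
    (hprobe : ∀ j, IsProbe (P j) (probe j))
    (hcol : ∀ i j, (squaredGraph P).Adj i j → col i ≠ col j)
    (hL : 2 ≤ L) (hN : 0 < N) (hK : 0 < K) {A η δ : ℝ} (hA : 0 < A) (hη : 0 < η)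
    (hbias : 2 * (L : ℝ) ^ 3 / A * (2 * (D + 1) * ‖θ‖ * A) ^ L ≤ η)
    (hvar : 4 * (L : ℝ) ^ 5 / (A ^ 2 * N) / η ^ 2 ≤ 1 / 64)
    (hr : r ≠ 0) (hδ : 0 ≤ δ) (hfail : (1 / 4 : ℝ) ^ K ≤ δ / r) :
    ENNReal.ofReal (1 - δ) ≤ recordLaw P θ probe col N L K A
      {data | ∀ j, |(processData probe A col data).val j - θ j| ≤ 2 * η} := by
  have hprob : ∀ w : Run m N L K,
      IsProbabilityMeasure ((queries P probe col N L K A w).law (hamiltonian P θ)) := fun w =>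
    isProbabilityMeasure_law (hamiltonian_conjTranspose P θ)
      (isState_of_mem_convexHull (initialState_mem_convexHull hprobe hcol _))
  set ν := recordLaw P θ probe col N L K A with hν
  have hνp : IsProbabilityMeasure ν := by rw [hν]; unfold recordLaw; infer_instance
  set good := {data : Record n m N L K |
    ∀ j, |(processData probe A col data).val j - θ j| ≤ 2 * η} with hgood
  have hbad : ν goodᶜ ≤ ENNReal.ofReal δ := by
    have hsub : goodᶜ ⊆ ⋃ j ∈ (Finset.univ : Finset (Fin r)),
        {data | ¬ |(processData probe A col data).val j - θ j| ≤ 2 * η} := by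
      intro data hdata
      obtain ⟨j, hj⟩ := not_forall.1 hdata
      exact Set.mem_biUnion (Finset.mem_coe.2 (Finset.mem_univ j)) hj
    refine (measure_mono hsub).trans ((measure_biUnion_finset_le _ _).trans ?_)
    refine (Finset.sum_le_card_nsmul _ _ (ENNReal.ofReal (δ / r)) fun j _ =>
      (measure_median_far_le hD hinj hprobe hcol hL hN hK hA hη hbias hvar j).trans
        (ENNReal.ofReal_le_ofReal hfail)).trans ?_
    rw [Finset.card_univ, Fintype.card_fin, nsmul_eq_mul, ← ENNReal.ofReal_natCast,
      ← ENNReal.ofReal_mul (by positivity), mul_div_cancel₀ _ (Nat.cast_ne_zero.2 hr)]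
  have h1 := prob_add_prob_compl (μ := ν) (Set.toFinite good).measurableSet
  rw [ENNReal.ofReal_sub _ hδ, ENNReal.ofReal_one, ← h1]
  exact tsub_le_iff_right.2 (by gcongr)

end Estimator

/-! ### Running time -/

section RunningTime

variable {n r m N L K : ℕ}

lemma processData_steps (probe : Fin r → Fin n × Axis) (A : ℝ) (col : Fin r → Fin (m + 1))
    (data : Record n m N L K) (hK : 0 < K) :
    (processData probe A col data).steps ≤
      r * (K * (L * (4 * N + 2) + (L * (L * (4 * L + 11) + 8) + 5)) + 4002 * K + 33) := by
  unfold processData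
  refine (steps_tabulate_le (c := K * (L * (4 * N + 2) + (L * (L * (4 * L + 11) + 8) + 5)) +
    4002 * K + 32) _ fun j => ?_).trans (by ring_nf; exact le_rfl)
  have hy : ∀ k : Fin K, (tabulate fun l : Fin L => do
        let s ← Timed.sum Finset.univ fun i : Fin N => do
          let b ← op (data (col j, k, l, i) (probe j).1)
          op (sgn b)
        op (s / (N : ℝ))).steps ≤ L * (4 * N + 2) := fun k => by
    refine steps_tabulate_le (c := 4 * N + 1) _ fun l => ?_
    have := steps_sum_le (c := 2) (Finset.univ : Finset (Fin N)) (fun i => do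
          let b ← op (data (col j, k, l, i) (probe j).1)
          op (sgn b)) fun i _ => le_rfl
    rw [Finset.card_univ, Fintype.card_fin] at this
    rw [steps_bind, steps_op]
    omega
  have hest := steps_tabulate_le (c := L * (4 * N + 2) + (L * (L * (4 * L + 11) + 8) + 4))
    (fun k : Fin K => do
      let y ← tabulate fun l : Fin L => do
        let s ← Timed.sum Finset.univ fun i : Fin N => do
          let b ← op (data (col j, k, l, i) (probe j).1)
          op (sgn b)
        op (s / (N : ℝ))
      let d ← derivativeT A y
      op (d / 2)) fun k => by
        rw [steps_bind, steps_bind, steps_op]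
        have h1 := hy k
        have h2 := derivativeT_steps A (tabulate fun l : Fin L => do
          let s ← Timed.sum Finset.univ fun i : Fin N => do
            let b ← op (data (col j, k, l, i) (probe j).1)
            op (sgn b)
          op (s / (N : ℝ))).val
        omega
  have hmed : ∀ f : Fin K → ℝ, (medianT (Timed.toList f).val).steps ≤ 4001 * K + 30 := fun f => by
    have := (medianT_spec (List.ofFn f) (by rw [ne_eq, List.ofFn_eq_nil_iff]; omega)).1
    rwa [List.length_ofFn] at this
  rw [steps_bind, steps_bind, steps_bind, steps_op, val_op]
  refine (Nat.add_le_add_left (Nat.add_le_add hest (Nat.add_le_add_left (hmed _) _)) 1).trans ?_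
  have e : ∀ f : Fin K → ℝ, (Timed.toList f).steps = K + 1 := fun _ => rfl
  rw [e, add_assoc (L * (4 * N + 2)), add_assoc (L * (L * (4 * L + 11) + 8))]
  omega

/-- Under `L ^ 2 ≤ N` and `D ^ 2 ≤ N`, averaging the outcomes dominates the regression and the
coloring. -/
lemma classicalPart_steps {D : ℕ} {P : Fin r → PauliString n}
    (hD : (interactionGraph P).maxDegree = D) (hD1 : 1 ≤ D) (hr : 1 ≤ r)
    (probe : Fin r → Fin n × Axis) (A : ℝ) (data : Record n (D ^ 2) N L K)
    (hK : 0 < K) (hL : 0 < L) (hLN : L ^ 2 ≤ N) (hDN : D ^ 2 ≤ N) :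
    (classicalPart (D ^ 2) P probe A data).steps ≤ 5000 * (r * (K * (L * N))) := by
  have h1 := (graphColor_proper P hD).2
  have h2 := processData_steps probe A (graphColor (D ^ 2) (adjList P)).val data hK
  have e : (classicalPart (D ^ 2) P probe A data).steps =
      (graphColor (D ^ 2) (adjList P)).steps +
        (processData probe A (graphColor (D ^ 2) (adjList P)).val data).steps := rfl
  have hN : 1 ≤ N := le_trans (Nat.one_le_pow _ _ hL) hLN
  have hLN1 : 1 ≤ L * N := Nat.mul_pos hL hN
  have hNLN : N ≤ L * N := Nat.le_mul_of_pos_left N hL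
  have hLLN : L ≤ L * N := Nat.le_mul_of_pos_right L hN
  have hL3 : L * L ^ 2 ≤ L * N := Nat.mul_le_mul_left L hLN
  have hK1 : K ≤ K * (L * N) := Nat.le_mul_of_pos_right K hLN1
  have hKLN : L * N ≤ K * (L * N) := Nat.le_mul_of_pos_left _ hK
  have hrK : r ≤ r * (K * (L * N)) := Nat.le_mul_of_pos_right r (Nat.mul_pos hK hLN1)
  have hk : L * (4 * N + 2) + (L * (L * (4 * L + 11) + 8) + 5) ≤ 34 * (L * N) := by
    have : L * L ≤ L * N := Nat.mul_le_mul_left L ((Nat.le_self_pow two_ne_zero L).trans hLN)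
    ring_nf at *
    omega
  have hk2 : K * (L * (4 * N + 2) + (L * (L * (4 * L + 11) + 8) + 5)) ≤ 34 * (K * (L * N)) :=
    (Nat.mul_le_mul_left K hk).trans (le_of_eq (by ring))
  have hr2 : (processData probe A (graphColor (D ^ 2) (adjList P)).val data).steps ≤
      r * (4069 * (K * (L * N))) := h2.trans (Nat.mul_le_mul_left r (by omega))
  have hD2 : 6 * D ^ 2 + 4 * D + 9 ≤ 19 * (K * (L * N)) := by
    have : D ≤ D ^ 2 := Nat.le_self_pow two_ne_zero D
    have : 1 ≤ D ^ 2 := Nat.one_le_pow _ _ hD1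
    omega
  have hr1 : r * (6 * D ^ 2 + 4 * D + 9) ≤ r * (19 * (K * (L * N))) := Nat.mul_le_mul_left r hD2
  have e1 : r * (19 * (K * (L * N))) = 19 * (r * (K * (L * N))) := by ring
  have e2 : r * (4069 * (K * (L * N))) = 4069 * (r * (K * (L * N))) := by ring
  omega

end RunningTime

/-! ### Choice of the parameters -/

section Parameters

/-- The number of Chebyshev nodes: relative to `‖θ‖`, the bias is at most `32 D L³ 4⁻ᴸ` and has to
be at most `ε / 2`. From `L = 8` on, `L³` is at most `4 * 2ᴸ`, and `2 * log (D / ε)` further nodes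
make up for the factor `D / ε`. -/
noncomputable def nodeCount (D : ℕ) (ε : ℝ) : ℕ := 8 + ⌈2 * Real.log (D / ε)⌉₊

/-- The number of shots: relative to `‖θ‖`, the variance of one estimate is at most
`1024 L⁵ D² / N` and has to be at most `(ε / 2)² / 64`. -/
noncomputable def shotCount (D : ℕ) (ε : ℝ) : ℕ :=
  ⌈262144 * (nodeCount D ε : ℝ) ^ 5 * D ^ 2 / ε ^ 2⌉₊

/-- The number of repetitions: the median fails with probability at most `4⁻ᴷ ≤ δ / r`. -/
noncomputable def repetitionCount (r : ℕ) (δ : ℝ) : ℕ := ⌈Real.log (r / δ)⌉₊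

lemma cube_le_two_pow {L : ℕ} (hL : 8 ≤ L) : L ^ 3 ≤ 4 * 2 ^ L := by
  induction L, hL using Nat.le_induction with
  | base => norm_num
  | succ L hL ih =>
    have : (L + 1) ^ 3 ≤ 2 * L ^ 3 := by nlinarith [mul_le_mul hL hL (by omega) (by omega)]
    rw [pow_succ 2 L]
    omega

lemma exp_half_le_two : Real.exp (1 / 2) ≤ 2 := by
  have h1 : Real.exp (1 / 2) ^ 2 = Real.exp 1 := by
    rw [← Real.exp_nat_mul]; norm_num
  have h2 := Real.exp_one_lt_d9
  have h3 := Real.exp_pos (1 / 2)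
  nlinarith

variable {D : ℕ} {ε : ℝ}

lemma log_div_nonneg (hD : 1 ≤ D) (hε : 0 < ε) (hε1 : ε ≤ 1) : 0 ≤ Real.log (D / ε) := by
  have hD' : (1 : ℝ) ≤ D := by exact_mod_cast hD
  exact Real.log_nonneg ((one_le_div hε).2 (hε1.trans hD'))

lemma le_two_pow_nodeCount (hD : 1 ≤ D) (hε : 0 < ε) :
    256 * D ≤ ε * 2 ^ nodeCount D ε := by
  have hD' : (0 : ℝ) < D := by exact_mod_cast hD
  have h : (D : ℝ) / ε ≤ 2 ^ ⌈2 * Real.log (D / ε)⌉₊ := by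
    calc (D : ℝ) / ε = Real.exp (Real.log (D / ε)) := (Real.exp_log (by positivity)).symm
      _ ≤ Real.exp (⌈2 * Real.log (D / ε)⌉₊ * (1 / 2)) := by
          have := Nat.le_ceil (2 * Real.log (D / ε))
          exact Real.exp_le_exp.2 (by linarith)
      _ = Real.exp (1 / 2) ^ ⌈2 * Real.log (D / ε)⌉₊ := Real.exp_nat_mul _ _
      _ ≤ _ := by gcongr; exact exp_half_le_two
  rw [div_le_iff₀ hε] at h
  rw [nodeCount, pow_add]
  norm_num
  linarith

lemma nodeCount_le (hD : 1 ≤ D) (hε : 0 < ε) (hε1 : ε ≤ 1) :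
    (nodeCount D ε : ℝ) ≤ 10 * (1 + Real.log (D / ε)) := by
  have h0 := log_div_nonneg hD hε hε1
  have := Nat.ceil_lt_add_one (mul_nonneg zero_le_two h0)
  rw [nodeCount]
  push_cast
  linarith

lemma le_shotCount (hD : 1 ≤ D) (hε : 0 < ε) (hε1 : ε ≤ 1) :
    nodeCount D ε ^ 2 ≤ shotCount D ε ∧ D ^ 2 ≤ shotCount D ε := by
  have hL : (1 : ℝ) ≤ nodeCount D ε := by
    exact_mod_cast (by unfold nodeCount; omega : 1 ≤ nodeCount D ε)
  have hD' : (1 : ℝ) ≤ D := by exact_mod_cast hD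
  have hN := Nat.le_ceil (262144 * (nodeCount D ε : ℝ) ^ 5 * D ^ 2 / ε ^ 2)
  have hε2 : ε ^ 2 ≤ 1 := pow_le_one₀ hε.le hε1
  have h1 : (nodeCount D ε : ℝ) ^ 5 * D ^ 2 ≤
      262144 * (nodeCount D ε : ℝ) ^ 5 * D ^ 2 / ε ^ 2 := by
    rw [le_div_iff₀ (by positivity)]
    have h0 : 0 ≤ (nodeCount D ε : ℝ) ^ 5 * D ^ 2 := by positivity
    nlinarith
  have h2 : (nodeCount D ε : ℝ) ^ 2 ≤ (nodeCount D ε : ℝ) ^ 5 := pow_le_pow_right₀ hL (by norm_num)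
  have h3 : (1 : ℝ) ≤ (nodeCount D ε : ℝ) ^ 5 := one_le_pow₀ hL
  have h4 : (1 : ℝ) ≤ (D : ℝ) ^ 2 := one_le_pow₀ hD'
  constructor
  · have : (nodeCount D ε : ℝ) ^ 2 ≤ shotCount D ε := by
      refine le_trans ?_ (h1.trans hN)
      nlinarith
    exact_mod_cast this
  · have : (D : ℝ) ^ 2 ≤ shotCount D ε := by
      refine le_trans ?_ (h1.trans hN)
      nlinarith
    exact_mod_cast this

lemma shotCount_le (hD : 1 ≤ D) (hε : 0 < ε) (hε1 : ε ≤ 1) :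
    (shotCount D ε : ℝ) ≤ 524288 * (nodeCount D ε : ℝ) ^ 5 * D ^ 2 / ε ^ 2 := by
  have h := (Nat.ceil_lt_add_one (by positivity :
    0 ≤ 262144 * (nodeCount D ε : ℝ) ^ 5 * D ^ 2 / ε ^ 2)).le
  have hL : (1 : ℝ) ≤ nodeCount D ε := by
    exact_mod_cast (by unfold nodeCount; omega : 1 ≤ nodeCount D ε)
  have hD' : (1 : ℝ) ≤ D := by exact_mod_cast hD
  have h1 : 1 ≤ 262144 * (nodeCount D ε : ℝ) ^ 5 * D ^ 2 / ε ^ 2 := by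
    rw [le_div_iff₀ (by positivity), one_mul]
    have hε2 : ε ^ 2 ≤ 1 := pow_le_one₀ hε.le hε1
    have h3 : (1 : ℝ) ≤ (nodeCount D ε : ℝ) ^ 5 := one_le_pow₀ hL
    have h4 : (1 : ℝ) ≤ (D : ℝ) ^ 2 := one_le_pow₀ hD'
    nlinarith
  calc (shotCount D ε : ℝ) ≤ _ := h
    _ ≤ 262144 * (nodeCount D ε : ℝ) ^ 5 * D ^ 2 / ε ^ 2 +
        262144 * (nodeCount D ε : ℝ) ^ 5 * D ^ 2 / ε ^ 2 := by gcongr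
    _ = _ := by ring

variable {r : ℕ} {δ : ℝ}

lemma log_two_le (hr : 2 ≤ r) (hδ : 0 < δ) (hδ1 : δ < 1) : Real.log 2 ≤ Real.log (r / δ) := by
  have hr' : (2 : ℝ) ≤ r := by exact_mod_cast hr
  refine Real.log_le_log (by norm_num) (hr'.trans ?_)
  rw [le_div_iff₀ hδ]
  nlinarith

lemma repetitionCount_pos (hr : 2 ≤ r) (hδ : 0 < δ) (hδ1 : δ < 1) : 0 < repetitionCount r δ :=
  Nat.ceil_pos.2 ((Real.log_pos (by norm_num)).trans_le (log_two_le hr hδ hδ1))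

lemma repetitionCount_le (hr : 2 ≤ r) (hδ : 0 < δ) (hδ1 : δ < 1) :
    (repetitionCount r δ : ℝ) ≤ 3 * Real.log (r / δ) := by
  have h1 := log_two_le hr hδ hδ1
  have h2 := Real.log_two_gt_d9
  have h3 := Nat.ceil_lt_add_one (by linarith : 0 ≤ Real.log (r / δ))
  rw [repetitionCount]
  linarith

lemma quarter_pow_repetitionCount_le (hr : 2 ≤ r) (hδ : 0 < δ) :
    (1 / 4 : ℝ) ^ repetitionCount r δ ≤ δ / r := by
  have hr' : (0 : ℝ) < r := by exact_mod_cast (by omega : 0 < r)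
  have h4 : Real.exp 1 ≤ 4 := by linarith [Real.exp_one_lt_d9]
  have h : (r : ℝ) / δ ≤ 4 ^ repetitionCount r δ := by
    calc (r : ℝ) / δ = Real.exp (Real.log (r / δ)) := (Real.exp_log (by positivity)).symm
      _ ≤ Real.exp (repetitionCount r δ * 1) := by
          rw [mul_one]; exact Real.exp_le_exp.2 (Nat.le_ceil _)
      _ = Real.exp 1 ^ repetitionCount r δ := Real.exp_nat_mul _ _
      _ ≤ _ := by gcongr
  rw [one_div, inv_pow, ← inv_div]
  exact inv_anti₀ (by positivity) h

/-- The product that governs both the number of queries per color and the processing time per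
term. The constant is `3 * 524288 * 10 ^ 6`, from the bounds on the three factors. -/
lemma repetitions_mul_nodes_mul_shots_le (hD : 1 ≤ D) (hε : 0 < ε) (hε1 : ε ≤ 1) (hr : 2 ≤ r)
    (hδ : 0 < δ) (hδ1 : δ < 1) :
    (repetitionCount r δ : ℝ) * (nodeCount D ε * shotCount D ε) ≤
      1572864000000 * ((D : ℝ) ^ 2 * Real.log (r / δ) * (1 + Real.log (D / ε)) ^ 6 / ε ^ 2) := by
  have h0 := log_div_nonneg hD hε hε1
  have hl : 0 ≤ Real.log (r / δ) :=
    (Real.log_pos (by norm_num)).le.trans (log_two_le hr hδ hδ1)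
  calc (repetitionCount r δ : ℝ) * (nodeCount D ε * shotCount D ε)
      ≤ (3 * Real.log (r / δ)) * (nodeCount D ε *
          (524288 * (nodeCount D ε : ℝ) ^ 5 * D ^ 2 / ε ^ 2)) := by
        gcongr
        · exact repetitionCount_le hr hδ hδ1
        · exact shotCount_le hD hε hε1
    _ = (3 * Real.log (r / δ)) * (524288 * (nodeCount D ε : ℝ) ^ 6 * D ^ 2 / ε ^ 2) := by ring
    _ ≤ (3 * Real.log (r / δ)) *
          (524288 * (10 * (1 + Real.log (D / ε))) ^ 6 * D ^ 2 / ε ^ 2) := by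
        gcongr
        exact nodeCount_le hD hε hε1
    _ = _ := by ring

lemma bias_parameters (hD : 1 ≤ D) (hε : 0 < ε) {s A : ℝ} (hs : 0 < s)
    (hA : A = 1 / 8 * (1 / (2 * (D : ℝ) * s))) :
    2 * (nodeCount D ε : ℝ) ^ 3 / A * (2 * (D + 1) * s * A) ^ nodeCount D ε ≤ ε * s / 2 := by
  have hD' : (1 : ℝ) ≤ D := by exact_mod_cast hD
  have hA0 : 0 < A := by rw [hA]; positivity
  set L := nodeCount D ε with hL
  have h1 : 2 * (D + 1) * s * A ≤ 1 / 4 := by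
    rw [hA]
    have : 2 * ((D : ℝ) + 1) * s * (1 / 8 * (1 / (2 * (D : ℝ) * s))) = (D + 1) / (8 * D) := by
      field_simp
    rw [this, div_le_iff₀ (by positivity)]
    linarith
  have h2 : 2 * (L : ℝ) ^ 3 / A = 32 * D * s * L ^ 3 := by
    rw [hA]; field_simp; ring
  have h3 : (L : ℝ) ^ 3 ≤ 4 * 2 ^ L := by
    exact_mod_cast cube_le_two_pow (by rw [hL]; unfold nodeCount; omega : 8 ≤ L)
  have h4 : 256 * (D : ℝ) ≤ ε * 2 ^ L := le_two_pow_nodeCount hD hε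
  have hpow : (1 / 4 : ℝ) ^ L * (2 ^ L * 2 ^ L) = 1 := by
    rw [← mul_pow, ← mul_pow]; norm_num
  calc 2 * (L : ℝ) ^ 3 / A * (2 * (D + 1) * s * A) ^ L
      ≤ 32 * D * s * L ^ 3 * (1 / 4) ^ L := by
        rw [h2]; gcongr
    _ ≤ 32 * D * s * (4 * 2 ^ L) * (1 / 4) ^ L := by gcongr
    _ = s / 2 * (256 * D) * 2 ^ L * (1 / 4) ^ L := by ring
    _ ≤ s / 2 * (ε * 2 ^ L) * 2 ^ L * (1 / 4) ^ L := by gcongr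
    _ = ε * s / 2 * ((1 / 4 : ℝ) ^ L * (2 ^ L * 2 ^ L)) := by ring
    _ = ε * s / 2 := by rw [hpow, mul_one]

lemma variance_parameters (hD : 1 ≤ D) (hε : 0 < ε) {s A : ℝ} (hs : 0 < s)
    (hA : A = 1 / 8 * (1 / (2 * (D : ℝ) * s))) :
    4 * (nodeCount D ε : ℝ) ^ 5 / (A ^ 2 * shotCount D ε) / (ε * s / 2) ^ 2 ≤ 1 / 64 := by
  have hD' : (0 : ℝ) < D := by exact_mod_cast hD
  have hL : (0 : ℝ) < nodeCount D ε := by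
    exact_mod_cast (by unfold nodeCount; omega : 0 < nodeCount D ε)
  have hN := Nat.le_ceil (262144 * (nodeCount D ε : ℝ) ^ 5 * D ^ 2 / ε ^ 2)
  change _ ≤ (shotCount D ε : ℝ) at hN
  have hN0 : (0 : ℝ) < shotCount D ε := lt_of_lt_of_le (by positivity) hN
  have e : 4 * (nodeCount D ε : ℝ) ^ 5 / (A ^ 2 * shotCount D ε) / (ε * s / 2) ^ 2 =
      (262144 * (nodeCount D ε : ℝ) ^ 5 * D ^ 2 / ε ^ 2) / shotCount D ε * (1 / 64) := by
    rw [hA]; field_simp; norm_num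
  rw [e]
  have := (div_le_one hN0).2 hN
  linarith

end Parameters

end HamLearn

open HamLearn in
theorem mainTheorem1 :
    ∃ (C : ℝ) (p : ℕ), 0 < C ∧
      ∀ (r D : ℕ) (ε δ : ℝ), 1 ≤ D → 0 < ε → ε ≤ 1 → 0 < δ → δ < 1 →
      -- the number of shots, the Chebyshev degree, the number of repetitions, and `A / τ`
      ∃ (N L K : ℕ) (a : ℝ), 0 < a ∧
        ∀ (n : ℕ) (P : Fin r → PauliString n) (θ : Fin r → ℝ) (probe : Fin r → Fin n × Axis),
          Function.Injective P →
          (∀ j, P j ≠ fun _ => none) →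
          θ ≠ 0 →
          (interactionGraph P).maxDegree = D →
          (∀ j, pauliOp (singlePauli (probe j).1 (probe j).2) * pauliOp (P j) ≠
            pauliOp (P j) * pauliOp (singlePauli (probe j).1 (probe j).2)) →
          ∀ (τ A : ℝ) (col : Fin r → Fin (D ^ 2 + 1)),
            τ = 1 / (2 * (D : ℝ) * ‖θ‖) →
            A = a * τ →
            col = (graphColor (D ^ 2) (adjList P)).val →
            -- the coloring of the squared interaction graph is proper
            (∀ i j, (squaredGraph P).Adj i j → col i ≠ col j) ∧
            -- every query starts in a classical mixture of product states
            (∀ w : Run (D ^ 2) N L K,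
              (queries P probe col N L K A w).init ∈ convexHull ℝ (Set.range productState) ∧
                0 ≤ (queries P probe col N L K A w).time) ∧
            -- all coefficients are learned with high probability
            ENNReal.ofReal (1 - δ) ≤ recordLaw P θ probe col N L K A
              {data | ∀ j, |(classicalPart (D ^ 2) P probe A data).val j - θ j| ≤ ε * ‖θ‖} ∧
            -- query complexity
            (Fintype.card (Run (D ^ 2) N L K) : ℝ) ≤
              C * (D : ℝ) ^ 4 * Real.log (r / δ) * (1 + Real.log (D / ε)) ^ p / ε ^ 2 ∧
            -- classical processing time
            ∀ data : Record n (D ^ 2) N L K,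
              ((classicalPart (D ^ 2) P probe A data).steps : ℝ) ≤
                C * (D : ℝ) ^ 2 * r * Real.log (r / δ) * (1 + Real.log (D / ε)) ^ p / ε ^ 2 := by
  -- `A = τ / 8` makes `2 (D + 1) ‖θ‖ A`, the ratio at which the Taylor remainders decay, at most
  -- `1 / 4`
  refine ⟨5000 * 1572864000000, 6, by norm_num, fun r D ε δ hD hε hε1 hδ hδ1 =>
    ⟨shotCount D ε, nodeCount D ε, repetitionCount r δ, 1 / 8, by norm_num, ?_⟩⟩
  intro n P θ probe hinj _ hθ hdeg hcomm τ A col hτ hA hcolor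
  subst hcolor
  have hprobe : ∀ j, IsProbe (P j) (probe j) := fun j => isProbe_of_not_commute (hcomm j)
  have hcol := (graphColor_proper P hdeg).1
  -- a graph of positive degree has at least two vertices, which keeps `log (r / δ)` away from zero
  have hr : 2 ≤ r := by
    have hne : Nonempty (Fin r) := by
      by_contra h
      rw [not_nonempty_iff] at h
      exact hθ (Subsingleton.elim _ _)
    have := (interactionGraph P).maxDegree_lt_card_verts
    rw [Fintype.card_fin] at this
    omega
  have hs : 0 < ‖θ‖ := norm_pos_iff.2 hθ
  have hD' : (1 : ℝ) ≤ D := by exact_mod_cast hD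
  have hAe : A = 1 / 8 * (1 / (2 * (D : ℝ) * ‖θ‖)) := by rw [hA, hτ]
  have hA0 : 0 < A := by rw [hAe]; positivity
  have hK := repetitionCount_pos hr hδ hδ1
  have hL : 8 ≤ nodeCount D ε := by unfold nodeCount; omega
  obtain ⟨hLN, hDN⟩ := le_shotCount hD hε hε1
  have hN : 0 < shotCount D ε := lt_of_lt_of_le (Nat.pow_pos (by omega)) hDN
  have hprod := repetitions_mul_nodes_mul_shots_le hD hε hε1 hr hδ hδ1
  refine ⟨hcol, fun w => ⟨initialState_mem_convexHull hprobe hcol _, ?_⟩, ?_, ?_, fun data => ?_⟩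
  · have hz := abs_le.1 (abs_chebNode_le _ w.2.2.1)
    exact mul_nonneg (by positivity) (by linarith)
  · have h := le_recordLaw_forall_abs_sub_le hdeg hinj hprobe hcol (by omega) hN hK hA0
      (by positivity : 0 < ε * ‖θ‖ / 2) (bias_parameters hD hε hs hAe)
      (variance_parameters hD hε hs hAe) (by omega) hδ.le (quarter_pow_repetitionCount_le hr hδ)
    rw [mul_div_cancel₀ _ two_ne_zero] at h
    exact h
  · have hcard : (Fintype.card (Run (D ^ 2) (shotCount D ε) (nodeCount D ε)
        (repetitionCount r δ)) : ℝ) = ((D : ℝ) ^ 2 + 1) *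
          ((repetitionCount r δ : ℝ) * (nodeCount D ε * shotCount D ε)) := by
      simp [Fintype.card_prod]
    rw [hcard]
    have h1 : (D : ℝ) ^ 2 + 1 ≤ 5000 * (D : ℝ) ^ 2 := by nlinarith
    refine (mul_le_mul h1 hprod (by positivity) (by positivity)).trans (le_of_eq ?_)
    ring
  · have hsteps := classicalPart_steps hdeg hD (by omega) probe A data hK (by omega) hLN hDN
    have h1 : ((classicalPart (D ^ 2) P probe A data).steps : ℝ) ≤
        5000 * (r * ((repetitionCount r δ : ℝ) * (nodeCount D ε * shotCount D ε))) := by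
      exact_mod_cast hsteps
    refine h1.trans ((mul_le_mul_of_nonneg_left
      (mul_le_mul_of_nonneg_left hprod (by positivity)) (by norm_num)).trans (le_of_eq ?_))
    ring
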